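/- Notation. Let $[m]=\{1,\dots,m\}$. For $A\subseteq[m]$ let $|A|_\delta$ be the convex hull in $\mathbb{R}^\delta$ of the points $p(a)=(a,a^2,\dots,a^\delta)$, $a\in A$, and let $C(m,\delta)=|[m]|_\delta$ be the cyclic polytope; if $\# A=k+1$, we call $|A|_\delta$ a $k$-simplex. A triangulation of $C(m,\delta)$ is a set $\mathcal{T}$ of $(\delta+1)$-subsets of $[m]$ whose simplices $|S|_\delta$ cover $C(m,\delta)$ and satisfy $|S|_\delta\cap|S'|_\delta=|S\cap S'|_\delta$ for all $S,S'\in\mathcal{T}$. It defines a piecewise-linear section $s_{\mathcal{T}}\colon C(m,\delta)\to C(m,\delta+1)$ sending each $|S|_\delta$, $S\in\mathcal{T}$, affinely to $|S|_{\delta+1}$; likewise a simplex $|A|_\delta$ with $\# A\le\delta+1$ defines $s_{|A|}\colon|A|_\delta\to C(m,\delta+1)$. The set $\mathcal{S}_2(m,\delta)$ of triangulations is ordered by the second higher Stasheff--Tamari order: $$\mathcal{T}\leqslant_2\mathcal{T}'\iff s_{\mathcal{T}}(x)_{\delta+1}\leqslant s_{\mathcal{T}'}(x)_{\delta+1}\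 \text{ for all } x\in C(m,\delta).$$ A facet is a face of dimension $\delta-1$, and a lower facet is one visible from a very large negative last coordinate. A simplex $|A|_\delta$ is internal in $C(m,\delta)$ if it lies in no facet of $C(m,\delta)$. It is submerged by $\mathcal{T}$ if $s_{|A|}(x)_{\delta+1}\leqslant s_{\mathcal{T}}(x)_{\delta+1}$ for all $x\in|A|_\delta$. For a triangulation $\mathcal{T}$ of $C(m,2d+1)$, let $\mathring{e}(\mathcal{T})$ be the set of $(d+1)$-subsets $A$ of $[m]$ such that $|A|_{2d+1}$ is internal in $C(m,2d+1)$ and $A\subseteq S$ for some $S\in\mathcal{T}$. For a triangulation $\mathcal{T}$ of $C(m,2d)$, let $\mathrm{sub}_d(\mathcal{T})$ be the set of $(d+1)$-subsets $A$ of $[m]$ such that $|A|_{2d}$ is submerged by $\mathcal{T}$. Finally let $I(m,d)$ be the set of $(d+1)$-subsets $\{a_0<\dots<a_d\}$ of $[m]$ with $a_{i+1}\geqslant a_i+2$ for all $0\le i<d$, $a_0\ne1$ and $a_d\ne m$. Theorem. (1) Let $d\ge0$ and $m\ge2d+2$. The set of internal $d$-simplices of $C(m,2d+1)$ is $I(m,d)$,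 which has $\binom{m-d-2}{d+1}$ elements, and $\mathcal{T}\mapsto\mathring{e}(\mathcal{T})$ is an order embedding of $\mathcal{S}_2(m,2d+1)$ into the Boolean lattice $2^{I(m,d)}$ with its order reversed: it is injective, and $\mathcal{T}\leqslant_2\mathcal{T}'$ if and only if $\mathring{e}(\mathcal{T})\supseteq\mathring{e}(\mathcal{T}')$. This Boolean lattice is the smallest possible: if $\mathcal{S}_2(m,2d+1)$ has an order embedding into the reversed Boolean lattice of subsets of an $N$-element set, then $N\ge\binom{m-d-2}{d+1}$. (2) Let $d\ge1$ and $m\ge2d+1$. The set of internal $d$-simplices $|A|_{2d}$ of $C(m,2d)$ for which $|A|_{2d+1}$ lies in no lower facet of $C(m,2d+1)$ is $I(m+1,d)$, which has $\binom{m-d-1}{d+1}$ elements, and $\mathcal{T}\mapsto\mathrm{sub}_d(\mathcal{T})\cap I(m+1,d)$ is an order embedding of $\mathcal{S}_2(m,2d)$ into the Boolean lattice $2^{I(m+1,d)}$ ordered by inclusion. This Boolean lattice is the smallest possible: if $\mathcal{S}_2(m,2d)$ has an order embedding into the Boolean lattice of subsets of an $N$-element set, then $N\ge\binom{m-d-1}{d+1}$.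 -/

import Mathlib

/-- The point `p(i) = (i, i ^ 2, …, i ^ δ)` of the moment curve in `ℝ ^ δ`. -/
def momentPoint (δ : ℕ) (i : ℕ) : Fin δ → ℝ := fun j => (i : ℝ) ^ ((j : ℕ) + 1)

/-- The geometric simplex `|A|` in dimension `δ`: the convex hull of the points `p(a)`, `a ∈ A`. -/
def geomSimplex (δ : ℕ) (A : Finset ℕ) : Set (Fin δ → ℝ) :=
  convexHull ℝ (momentPoint δ '' (A : Set ℕ))

/-- The cyclic polytope `C(m, δ)`, on the vertex set `[m] = {1, …, m}`. -/
def cyclicPolytope (m δ : ℕ) : Set (Fin δ → ℝ) := geomSimplex δ (Finset.Icc 1 m)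

/-- A triangulation of `C(m, δ)`, given by the vertex sets of its `δ`-simplices: these cover the
polytope, and any two of them meet in the (possibly empty) face spanned by their common vertices. -/
@[ext]
structure Triangulation (m δ : ℕ) where
  simplices : Finset (Finset ℕ)
  vertices_subset : ∀ S ∈ simplices, S ⊆ Finset.Icc 1 m
  card_eq : ∀ S ∈ simplices, S.card = δ + 1
  cover : (⋃ S ∈ simplices, geomSimplex δ S) = cyclicPolytope m δ
  inter : ∀ S ∈ simplices, ∀ S' ∈ simplices,
    geomSimplex δ S ∩ geomSimplex δ S' = geomSimplex δ (S ∩ S')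

/-- The piecewise-linear section defined by a family `K` of simplices in dimension `δ`: a point `x`
of `⋃ S ∈ K, |S|` is sent to the point above it of `⋃ S ∈ K, |S|` in dimension `δ + 1`. That point
is unique when `K` is a triangulation, and when `K` consists of one simplex with at most `δ + 1`
vertices. -/
noncomputable def plSection (δ : ℕ) (K : Finset (Finset ℕ)) (x : Fin δ → ℝ) : Fin (δ + 1) → ℝ :=
  Classical.epsilon fun y => (∃ S ∈ K, y ∈ geomSimplex (δ + 1) S) ∧ Fin.init y = x

/-- The last coordinate of the section defined by `K`. -/
noncomputable def sectionHeight (δ : ℕ) (K : Finset (Finset ℕ)) (x : Fin δ → ℝ) : ℝ :=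
  plSection δ K x (Fin.last δ)

/-- The second higher Stasheff--Tamari order on the triangulations of `C(m, δ)`:
`T ≤ T'` when the section of `T` lies weakly below that of `T'` over every point of `C(m, δ)`. -/
noncomputable instance (m δ : ℕ) : Preorder (Triangulation m δ) :=
  Preorder.lift fun (T : Triangulation m δ) (x : cyclicPolytope m δ) =>
    sectionHeight δ T.simplices x

/-- A facet of `C(m, δ)`: a nonempty face of dimension `δ - 1`. -/
def IsFacet (m δ : ℕ) (F : Set (Fin δ → ℝ)) : Prop :=
  F.Nonempty ∧ IsExposed ℝ (cyclicPolytope m δ) F ∧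
    Module.finrank ℝ (vectorSpan ℝ F) + 1 = δ

/-- A lower facet of `C(m, δ + 1)`: a facet all of whose points are visible from a very large
negative last coordinate. -/
def IsLowerFacet (m δ : ℕ) (F : Set (Fin (δ + 1) → ℝ)) : Prop :=
  IsFacet m (δ + 1) F ∧
    ∀ x ∈ F, ∀ y ∈ cyclicPolytope m (δ + 1),
      Fin.init y = Fin.init x → x (Fin.last δ) ≤ y (Fin.last δ)

/-- `|A|` is internal in `C(m, δ)`: it does not lie in any facet. -/
def IsInternal (m δ : ℕ) (A : Finset ℕ) : Prop :=
  ∀ F, IsFacet m δ F → ¬ geomSimplex δ A ⊆ F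

open Classical in
/-- The internal `k`-simplices of `C(m, δ)`. -/
noncomputable def internalSimplices (m δ k : ℕ) : Finset (Finset ℕ) :=
  (Finset.powersetCard (k + 1) (Finset.Icc 1 m)).filter fun A => IsInternal m δ A

open Classical in
/-- The internal `k`-simplices of `C(m, δ)` which do not lie in a lower facet of `C(m, δ + 1)`. -/
noncomputable def internalNonLowerSimplices (m δ k : ℕ) : Finset (Finset ℕ) :=
  (internalSimplices m δ k).filter fun A =>
    ∀ F, IsLowerFacet m δ F → ¬ geomSimplex (δ + 1) A ⊆ F

open Classical in
/-- The internal `k`-simplices of the triangulation `T`, that is, the internal `k`-simplices which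
are faces of simplices of `T`. For `δ = 2 * d + 1` and `k = d` this is `e°(T)`. -/
noncomputable def Triangulation.internalFaces {m δ : ℕ} (T : Triangulation m δ) (k : ℕ) :
    Finset (Finset ℕ) :=
  (internalSimplices m δ k).filter fun A => ∃ S ∈ T.simplices, A ⊆ S

/-- `|A|` is submerged by `T`. -/
def Triangulation.Submerges {m δ : ℕ} (T : Triangulation m δ) (A : Finset ℕ) : Prop :=
  ∀ x ∈ geomSimplex δ A, sectionHeight δ {A} x ≤ sectionHeight δ T.simplices x

open Classical in
/-- The `k`-submersion set of `T`. -/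
noncomputable def Triangulation.submersionSet {m δ : ℕ} (T : Triangulation m δ) (k : ℕ) :
    Finset (Finset ℕ) :=
  (Finset.powersetCard (k + 1) (Finset.Icc 1 m)).filter fun A => T.Submerges A

/-- The separated `(d + 1)`-tuples `(a₀, …, a_d)` in `[m]` (those with `a_{i+1} ≥ a_i + 2`) such
that `a₀ ≠ 1` and `a_d ≠ m`. -/
def innerSeparated (m d : ℕ) : Finset (Finset ℕ) :=
  (Finset.powersetCard (d + 1) (Finset.Icc 1 m)).filter fun A =>
    (∀ a ∈ A, ∀ b ∈ A, a < b → a + 2 ≤ b) ∧ 1 ∉ A ∧ m ∉ A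

/-! Everything reduces to the circuits of the cyclic polytope: `δ + 2` integers, split alternately
into two classes, span two simplices which meet in a point, and one dimension up the class of the
greatest integer is the higher one there. Hence (`Triangulation.le_iff`) `T ≤ T'` fails exactly when
a simplex `S` of `T` and a simplex `S'` of `T'` carry an alternating sequence of length `δ + 2`
whose greatest term is in `S`. One direction counts sign changes of the difference of two weight
vectors of one point (`IsWeight.alternates`); the other reads weights off a divided difference
(`Alternates.exists_weights`).

Two simplices of one triangulation never alternate. So if `T ≤ T'` fails in dimension `2d + 1`, the
terms taken from `S'` form a separated set which is a face of `T'` but not of `T`; in dimension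
`2d`, the terms taken from `S` form a separated set submerged by `T` but not by `T'`. This gives the
nontrivial half of each embedding in its dimension. Gale's evenness condition for facets identifies
the separated sets with the internal simplices in question.

For minimality, let `g` have positive divided differences at `δ + 3` points, and take the regular
triangulations with heights `t i ^ (δ + 1) + g i`. Whether a given separated set belongs to the
invariant depends only on the sign of one divided difference, which is `t` plus a constant. For
suitable `g` these constants are distinct, so the sets enter or leave one at a time as `t` varies.
The resulting chain forces any Boolean lattice containing the order to have at least as many atoms
as there are separated sets. -/

open Finset Polynomial

/-! ### Barycentric weights and affine functions on the moment curve -/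

/-- `w` is a family of barycentric weights on the vertex set `A` for the point `x` of `|A|`. -/
structure IsWeight (δ : ℕ) (A : Finset ℕ) (w : ℕ → ℝ) (x : Fin δ → ℝ) : Prop where
  nonneg : ∀ i, 0 ≤ w i
  zero_off : ∀ i, i ∉ A → w i = 0
  sum_one : ∑ i ∈ A, w i = 1
  sum_eq : ∑ i ∈ A, w i • momentPoint δ i = x

theorem mem_geomSimplex_iff {δ : ℕ} {A : Finset ℕ} {x : Fin δ → ℝ} :
    x ∈ geomSimplex δ A ↔ ∃ w, IsWeight δ A w x := by
  constructor
  · intro hx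
    refine convexHull_min (t := {x | ∃ w, IsWeight δ A w x}) ?_ ?_ hx
    · rintro _ ⟨a, ha, rfl⟩
      have ha' : a ∈ A := ha
      refine ⟨Pi.single a 1, ?_, ?_, ?_, ?_⟩
      · intro i
        by_cases h : i = a <;> simp [h]
      · intro i hi
        have : i ≠ a := fun h => hi (h ▸ ha')
        simp [this]
      · simp [Pi.single_apply, ha']
      · simp [Pi.single_apply, ha']
    · rintro x ⟨w, hw⟩ y ⟨v, hv⟩ a b ha hb hab
      refine ⟨fun i => a * w i + b * v i, ?_, ?_, ?_, ?_⟩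
      · intro i
        have := hw.nonneg i
        have := hv.nonneg i
        positivity
      · intro i hi
        simp [hw.zero_off i hi, hv.zero_off i hi]
      · rw [sum_add_distrib, ← mul_sum, ← mul_sum, hw.sum_one, hv.sum_one]
        linarith
      · simp only [add_smul, mul_smul, sum_add_distrib, ← smul_sum, hw.sum_eq, hv.sum_eq]
  · rintro ⟨w, hw⟩
    rw [← hw.sum_eq]
    exact (convex_convexHull ℝ _).sum_mem (fun i _ => hw.nonneg i) hw.sum_one
      fun i hi => subset_convexHull ℝ _ ⟨i, hi, rfl⟩

/-- The value at `x` of the affine function on `ℝ ^ δ` which restricts to the polynomial `Q` on the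
moment curve. -/
noncomputable def momentEval (δ : ℕ) (Q : ℝ[X]) (x : Fin δ → ℝ) : ℝ :=
  Q.coeff 0 + ∑ j : Fin δ, Q.coeff (j + 1) * x j

theorem momentEval_momentPoint {δ : ℕ} {Q : ℝ[X]} (hQ : Q.natDegree ≤ δ) (i : ℕ) :
    momentEval δ Q (momentPoint δ i) = Q.eval (i : ℝ) := by
  rw [eval_eq_sum_range' (Nat.lt_succ_of_le hQ), sum_range_succ', sum_range, momentEval]
  simp [momentPoint, add_comm]

theorem IsWeight.mono {δ : ℕ} {A B : Finset ℕ} {w : ℕ → ℝ} {x : Fin δ → ℝ}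
    (h : IsWeight δ A w x) (hAB : A ⊆ B) : IsWeight δ B w x where
  nonneg := h.nonneg
  zero_off i hi := h.zero_off i fun h' => hi (hAB h')
  sum_one := by
    rw [← h.sum_one]
    exact (sum_subset hAB fun i _ hi => h.zero_off i hi).symm
  sum_eq := by
    rw [← h.sum_eq]
    exact (sum_subset hAB fun i _ hi => by simp [h.zero_off i hi]).symm

theorem IsWeight.of_support {δ : ℕ} {A B : Finset ℕ} {w : ℕ → ℝ} {x : Fin δ → ℝ}
    (h : IsWeight δ A w x) (hB : ∀ i, i ∉ B → w i = 0) : IsWeight δ B w x where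
  nonneg := h.nonneg
  zero_off := hB
  sum_one := by
    rw [← (h.mono (subset_union_left (s₂ := B))).sum_one]
    exact sum_subset subset_union_right fun i _ hi => hB i hi
  sum_eq := by
    rw [← (h.mono (subset_union_left (s₂ := B))).sum_eq]
    exact sum_subset subset_union_right fun i _ hi => by simp [hB i hi]

theorem IsWeight.sum_eval {δ : ℕ} {A : Finset ℕ} {w : ℕ → ℝ} {x : Fin δ → ℝ}
    (h : IsWeight δ A w x) {Q : ℝ[X]} (hQ : Q.natDegree ≤ δ) :
    ∑ i ∈ A, w i * Q.eval (i : ℝ) = momentEval δ Q x := by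
  rw [← h.sum_eq, momentEval]
  simp only [Finset.sum_apply, Pi.smul_apply, smul_eq_mul, mul_sum]
  rw [sum_comm]
  rw [← mul_one (Q.coeff 0), ← h.sum_one, mul_sum, ← sum_add_distrib]
  refine sum_congr rfl fun i _ => ?_
  rw [← momentEval_momentPoint hQ, momentEval, mul_add, mul_sum]
  congr 1
  · ring
  · exact sum_congr rfl fun j _ => by ring

theorem IsWeight.of_sum_pow {δ : ℕ} {A : Finset ℕ} {w : ℕ → ℝ} {x : Fin δ → ℝ}
    (nonneg : ∀ i, 0 ≤ w i) (zero_off : ∀ i, i ∉ A → w i = 0) (sum_one : ∑ i ∈ A, w i = 1)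
    (h : ∀ j : Fin δ, ∑ i ∈ A, w i * (i : ℝ) ^ ((j : ℕ) + 1) = x j) : IsWeight δ A w x :=
  ⟨nonneg, zero_off, sum_one, by ext j; simpa [momentPoint, Finset.sum_apply] using h j⟩

/-! ### Sign changes and divided differences -/

/-- Signs are collected greedily from the right. `Q` changes sign just above each place chosen so
far, which makes `ν * Q ≤ 0` from `N` on. Since `ν * Q` must be positive somewhere, `ν` takes the
next required sign left of `N`, and its greatest such place becomes `z k`. -/
theorem exists_sign_changes_aux (ν : ℕ → ℝ) (M : ℕ) (hM : ∀ i, M ≤ i → ν i = 0) (n : ℕ)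
    (hν : ∀ Q : ℝ[X], Q.Monic → Q.natDegree < n → (∀ i : ℕ, Q.eval (i : ℝ) ≠ 0) →
      ∃ i, 0 < ν i * Q.eval (i : ℝ)) (k : ℕ) (hk : k ≤ n) :
    ∃ (N : ℕ) (Q : ℝ[X]) (z : ℕ → ℕ), Q.Monic ∧ Q.natDegree = k ∧
      (∀ i : ℕ, Q.eval (i : ℝ) ≠ 0) ∧ (∀ i, N ≤ i → ν i * Q.eval (i : ℝ) ≤ 0) ∧
      (∀ i < N, 0 < (-1) ^ k * Q.eval (i : ℝ)) ∧ (∀ i < k, N ≤ z i) ∧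
      (∀ i < k, 0 < (-1) ^ i * ν (z i)) ∧ (∀ j < k, ∀ i < j, z j < z i) := by
  induction k with
  | zero => exact ⟨M, 1, fun _ => 0, monic_one, by simp, by simp, fun i hi => by simp [hM i hi],
      by simp, by simp, by simp, by simp⟩
  | succ k ih =>
    obtain ⟨N, Q, z, hQ, hdeg, hne, hge, hlt, hNz, hz, hanti⟩ := ih (by omega)
    obtain ⟨i₀, hi₀⟩ := hν Q hQ (by omega) hne
    have hpos : ∀ i < N, (0 < ν i * Q.eval (i : ℝ) ↔ 0 < (-1) ^ k * ν i) := by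
      intro i hi
      have h1 := hlt i hi
      have h2 : ((-1 : ℝ) ^ k) * (-1) ^ k = 1 := by rw [← mul_pow]; simp
      have h3 : ν i * Q.eval (i : ℝ) = ((-1) ^ k * ν i) * ((-1) ^ k * Q.eval (i : ℝ)) := by
        linear_combination (-(ν i * Q.eval (i : ℝ))) * h2
      rw [h3]
      exact mul_pos_iff_of_pos_right h1
    have hi₀N : i₀ < N := by
      by_contra h
      exact absurd (hge i₀ (by omega)) (not_le.2 hi₀)
    let P : Finset ℕ := (range N).filter fun i => 0 < (-1 : ℝ) ^ k * ν i
    have hP : P.Nonempty := ⟨i₀, by simp [P, hi₀N, (hpos i₀ hi₀N).1 hi₀]⟩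
    obtain ⟨y, hyP, hymax⟩ := P.exists_max_image id hP
    obtain ⟨hyN, hy⟩ : y < N ∧ 0 < (-1 : ℝ) ^ k * ν y := by simpa [P] using hyP
    have hmax : ∀ i < N, y < i → ν i * Q.eval (i : ℝ) ≤ 0 := by
      intro i hi hyi
      by_contra h
      have := hymax i (by simp [P, hi, (hpos i hi).1 (not_le.1 h)])
      simp at this
      omega
    -- A root at a half-integer flips the sign at the integers up to `y` only and never makes `Q`
    -- vanish at an integer.
    have hfac : (X - C ((y : ℝ) + 1 / 2)).Monic := monic_X_sub_C _
    have hfpos : ∀ i, y < i → 0 < (i : ℝ) - (y + 1 / 2) := by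
      intro i hi
      have : (y : ℝ) + 1 ≤ i := by exact_mod_cast hi
      linarith
    have hfneg : ∀ i, i ≤ y → (i : ℝ) - (y + 1 / 2) < 0 := by
      intro i hi
      have : (i : ℝ) ≤ y := by exact_mod_cast hi
      linarith
    refine ⟨y, Q * (X - C ((y : ℝ) + 1 / 2)), fun i => if i = k then y else z i, hQ.mul hfac, ?_,
      ?_, ?_, ?_, ?_, ?_, ?_⟩
    · rw [hQ.natDegree_mul hfac, hdeg, natDegree_X_sub_C]
    · intro i
      simp only [eval_mul, eval_sub, eval_X, eval_C]
      rcases lt_or_ge y i with h | h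
      · exact mul_ne_zero (hne i) (hfpos i h).ne'
      · exact mul_ne_zero (hne i) (hfneg i h).ne
    · intro i hi
      simp only [eval_mul, eval_sub, eval_X, eval_C]
      rw [← mul_assoc]
      rcases hi.eq_or_lt with rfl | h
      · exact mul_nonpos_of_nonneg_of_nonpos ((hpos y hyN).2 hy).le (hfneg y le_rfl).le
      · refine mul_nonpos_of_nonpos_of_nonneg ?_ (hfpos i h).le
        rcases lt_or_ge i N with h' | h'
        · exact hmax i h' h
        · exact hge i h'
    · intro i hi
      simp only [eval_mul, eval_sub, eval_X, eval_C]
      have h1 := hlt i (by omega)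
      have h2 := hfneg i hi.le
      have := mul_pos_of_neg_of_neg (neg_neg_of_pos h1) h2
      rw [pow_succ]
      linarith
    · intro i hi
      dsimp only
      split_ifs with h
      · exact le_rfl
      · have := hNz i (by omega)
        omega
    · intro i hi
      dsimp only
      split_ifs with h
      · rw [h]; exact hy
      · exact hz i (by omega)
    · intro j hj i hi
      have hik : i ≠ k := by omega
      simp only [hik, if_false]
      split_ifs with h
      · have := hNz i (by omega)
        omega
      · exact hanti j (by omega) i hi

/-- A real function on `{0, …, M - 1}` which annihilates the polynomials of degree at most `δ`, and
whose pairing with `x ^ (δ + 1)` is nonnegative, changes sign `δ + 1` times, and its last sign may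
be taken to be positive. -/
theorem exists_sign_changes {δ : ℕ} {ν : ℕ → ℝ} {R : Finset ℕ} (hR : ∀ i, i ∉ R → ν i = 0)
    (hne : ∃ i, ν i ≠ 0)
    (hν : ∀ Q : ℝ[X], Q.natDegree ≤ δ → ∑ i ∈ R, ν i * Q.eval (i : ℝ) = 0)
    (htop : 0 ≤ ∑ i ∈ R, ν i * (i : ℝ) ^ (δ + 1)) :
    ∃ z : ℕ → ℕ, (∀ j < δ + 2, ∀ i < j, z j < z i) ∧ ∀ i < δ + 2, 0 < (-1) ^ i * ν (z i) := by
  obtain ⟨M, hM⟩ : ∃ M, R ⊆ range M := R.exists_nat_subset_range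
  obtain ⟨_, _, z, _, _, _, _, _, _, hz, hanti⟩ := exists_sign_changes_aux ν M
    (fun i hi => hR i fun h => by simpa [hi.not_gt] using hM h) (δ + 2) (by
      intro Q hQ hdeg hQne
      have hsum : 0 ≤ ∑ i ∈ R, ν i * Q.eval (i : ℝ) := by
        rcases (Nat.lt_succ_iff.1 hdeg).lt_or_eq with h | h
        · rw [hν Q (by omega)]
        · have h1 : (Q - X ^ (δ + 1)).natDegree ≤ δ := by
            have := degree_sub_lt_left (p := Q) (q := X ^ (δ + 1))
              (by rw [degree_X_pow, degree_eq_natDegree hQ.ne_zero, h]) hQ.ne_zero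
              (by rw [hQ.leadingCoeff, leadingCoeff_X_pow])
            rw [degree_eq_natDegree hQ.ne_zero, h] at this
            exact natDegree_le_iff_coeff_eq_zero.2 fun N hN =>
              coeff_eq_zero_of_degree_lt (this.trans_le (by exact_mod_cast hN))
          have h2 := hν _ h1
          simp only [eval_sub, eval_pow, eval_X, mul_sub, sum_sub_distrib] at h2
          linarith
      by_contra hcon
      push Not at hcon
      obtain ⟨i, hi⟩ := hne
      have hiR : i ∈ R := by
        by_contra h
        exact hi (hR i h)
      have : ∑ i ∈ R, ν i * Q.eval (i : ℝ) < 0 :=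
        sum_neg' (fun i _ => hcon i) ⟨i, hiR, lt_of_le_of_ne (hcon i) (mul_ne_zero hi (hQne i))⟩
      linarith) (δ + 2) le_rfl
  exact ⟨z, hanti, hz⟩

/-- The coefficient of `f i` in the divided difference of `f` at the points of `Z`. -/
noncomputable def divWeight (Z : Finset ℕ) (i : ℕ) : ℝ :=
  Lagrange.nodalWeight Z (fun j : ℕ => (j : ℝ)) i

/-- The divided difference of `f` at the points of `Z`. -/
noncomputable def dividedDifference (f : ℕ → ℝ) (Z : Finset ℕ) : ℝ :=
  ∑ i ∈ Z, divWeight Z i * f i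

theorem dividedDifference_add (f g : ℕ → ℝ) (Z : Finset ℕ) :
    dividedDifference (fun i => f i + g i) Z = dividedDifference f Z + dividedDifference g Z := by
  simp [dividedDifference, mul_add, sum_add_distrib]

theorem dividedDifference_sub (f g : ℕ → ℝ) (Z : Finset ℕ) :
    dividedDifference (fun i => f i - g i) Z = dividedDifference f Z - dividedDifference g Z := by
  simp [dividedDifference, mul_sub, sum_sub_distrib]

theorem dividedDifference_const_mul (c : ℝ) (f : ℕ → ℝ) (Z : Finset ℕ) :
    dividedDifference (fun i => c * f i) Z = c * dividedDifference f Z := by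
  simp [dividedDifference, mul_left_comm, mul_sum]

theorem dividedDifference_congr {f g : ℕ → ℝ} {Z : Finset ℕ} (h : ∀ i ∈ Z, f i = g i) :
    dividedDifference f Z = dividedDifference g Z :=
  sum_congr rfl fun i hi => by rw [h i hi]

theorem dividedDifference_eval {Z : Finset ℕ} {Q : ℝ[X]} (hQ : Q.natDegree < #Z) :
    dividedDifference (fun i => Q.eval (i : ℝ)) Z = Q.coeff (#Z - 1) := by
  rw [Lagrange.coeff_eq_sum (s := Z) (v := fun j : ℕ => (j : ℝ)) (by simp [Nat.cast_injective.injOn])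
    (degree_le_natDegree.trans_lt (by exact_mod_cast hQ))]
  refine sum_congr rfl fun i _ => ?_
  rw [divWeight, Lagrange.nodalWeight, prod_inv_distrib, div_eq_mul_inv, mul_comm]

theorem dividedDifference_eval_eq_zero {Z : Finset ℕ} {Q : ℝ[X]} (hQ : Q.natDegree + 1 < #Z) :
    dividedDifference (fun i => Q.eval (i : ℝ)) Z = 0 := by
  rw [dividedDifference_eval (by omega), coeff_eq_zero_of_natDegree_lt (by omega)]

theorem divWeight_ne_zero {Z : Finset ℕ} {i : ℕ} (hi : i ∈ Z) : divWeight Z i ≠ 0 :=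
  Lagrange.nodalWeight_ne_zero (by simp [Nat.cast_injective.injOn]) hi

/-- The first `n` terms of the sequence `z` are strictly decreasing. -/
def IsDecreasing (n : ℕ) (z : ℕ → ℕ) : Prop := ∀ j < n, ∀ i < j, z j < z i

theorem IsDecreasing.injOn {n : ℕ} {z : ℕ → ℕ} (hz : IsDecreasing n z) :
    Set.InjOn z (range n : Set ℕ) := by
  intro i hi j hj hij
  simp only [coe_range, Set.mem_Iio] at hi hj
  rcases lt_trichotomy i j with h | h | h
  · have := hz j hj i h
    omega
  · exact h
  · have := hz i hi j h
    omega

theorem IsDecreasing.card_image {n : ℕ} {z : ℕ → ℕ} (hz : IsDecreasing n z) :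
    #((range n).image z) = n := by
  rw [card_image_of_injOn hz.injOn, card_range]

/-- The factor of the weight coming from `z j` is negative exactly for `j < i`, so there are `i`
negative factors. -/
theorem IsDecreasing.divWeight_sign {n : ℕ} {z : ℕ → ℕ} (hz : IsDecreasing n z) {i : ℕ}
    (hi : i < n) : 0 < (-1) ^ i * divWeight ((range n).image z) (z i) := by
  have himage : ((range n).image z).erase (z i) = ((range n).erase i).image z := by
    ext k
    simp only [mem_erase, mem_image, mem_range]
    constructor
    · rintro ⟨hk, j, hj, rfl⟩
      exact ⟨j, ⟨fun h => hk (h ▸ rfl), hj⟩, rfl⟩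
    · rintro ⟨j, ⟨hji, hj⟩, rfl⟩
      exact ⟨fun h => hji (hz.injOn (by simpa using hj) (by simpa using hi) h), j, hj, rfl⟩
  have hsign : ((-1 : ℝ)) ^ i = ∏ j ∈ (range n).erase i, if j < i then (-1 : ℝ) else 1 := by
    rw [prod_ite]
    have : ((range n).erase i).filter (fun j => j < i) = range i := by
      ext j
      simp only [mem_filter, mem_erase, mem_range]
      omega
    simp [this]
  rw [divWeight, Lagrange.nodalWeight, himage, prod_image, hsign, ← prod_mul_distrib]
  · refine prod_pos fun j hj => ?_
    simp only [mem_erase, mem_range] at hj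
    split_ifs with h
    · have : (z i : ℝ) < z j := by exact_mod_cast hz i hi j h
      rw [neg_one_mul]
      exact neg_pos.2 (inv_neg''.2 (by linarith))
    · have : (z j : ℝ) < z i := by exact_mod_cast hz j hj.2 i (by omega)
      rw [one_mul]
      exact inv_pos.2 (by linarith)
  · exact hz.injOn.mono (coe_subset.2 (erase_subset _ _))

/-! ### Alternating sets: the circuits of the cyclic polytope -/

/-- There are `n` integers, taken alternately from `S` and from `S'`, the greatest one from `S`. -/
def Alternates (n : ℕ) (S S' : Finset ℕ) : Prop :=
  ∃ z, IsDecreasing n z ∧ (∀ i < n, Even i → z i ∈ S) ∧ ∀ i < n, Odd i → z i ∈ S'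

theorem Alternates.mono {n : ℕ} {A B A' B' : Finset ℕ} (h : Alternates n A A') (hA : A ⊆ B)
    (hA' : A' ⊆ B') : Alternates n B B' := by
  obtain ⟨z, hz, h1, h2⟩ := h
  exact ⟨z, hz, fun i hi he => hA (h1 i hi he), fun i hi ho => hA' (h2 i hi ho)⟩

theorem Alternates.le_card {n : ℕ} {S : Finset ℕ} (h : Alternates n S S) : n ≤ #S := by
  obtain ⟨z, hz, h1, h2⟩ := h
  rw [← hz.card_image]
  refine card_le_card fun k hk => ?_
  obtain ⟨i, hi, rfl⟩ := mem_image.1 hk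
  rcases Nat.even_or_odd i with he | ho
  · exact h1 i (mem_range.1 hi) he
  · exact h2 i (mem_range.1 hi) ho

theorem sum_mul_eq_of_support {A B : Finset ℕ} {w : ℕ → ℝ} (hA : ∀ i, i ∉ A → w i = 0)
    (hB : ∀ i, i ∉ B → w i = 0) (f : ℕ → ℝ) : ∑ i ∈ A, w i * f i = ∑ i ∈ B, w i * f i := by
  rw [sum_subset (subset_union_left (s₁ := A) (s₂ := B)) fun i _ hi => by simp [hA i hi],
    sum_subset (subset_union_right (s₁ := A) (s₂ := B)) fun i _ hi => by simp [hB i hi]]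

/-- The function `w - w'` annihilates degree at most `δ` and pairs nonnegatively with the next
power, so `exists_sign_changes` applies. It can be positive only on `S` and negative only on `S'`.
-/
theorem IsWeight.alternates {δ : ℕ} {S S' : Finset ℕ} {w w' : ℕ → ℝ} {x : Fin δ → ℝ}
    (h : IsWeight δ S w x) (h' : IsWeight δ S' w' x) (hne : w ≠ w')
    (hle : ∑ i ∈ S', w' i * (i : ℝ) ^ (δ + 1) ≤ ∑ i ∈ S, w i * (i : ℝ) ^ (δ + 1)) :
    Alternates (δ + 2) S S' := by
  have hu := h.mono (subset_union_left (s₂ := S'))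
  have hu' := h'.mono (subset_union_right (s₁ := S))
  rw [sum_mul_eq_of_support h'.zero_off hu'.zero_off, sum_mul_eq_of_support h.zero_off hu.zero_off]
    at hle
  obtain ⟨z, hz, hsign⟩ := exists_sign_changes (δ := δ) (ν := fun i => w i - w' i) (R := S ∪ S')
    (fun i hi => by simp [hu.zero_off i hi, hu'.zero_off i hi])
    (by
      by_contra hcon
      push Not at hcon
      exact hne (funext fun i => sub_eq_zero.1 (hcon i)))
    (fun Q hQ => by
      simp only [sub_mul, sum_sub_distrib]
      rw [hu.sum_eval hQ, hu'.sum_eval hQ, sub_self])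
    (by
      simp only [sub_mul, sum_sub_distrib]
      linarith)
  refine ⟨z, hz, fun i hi he => ?_, fun i hi ho => ?_⟩
  · by_contra hcon
    have h1 := hsign i hi
    rw [he.neg_one_pow, h.zero_off _ hcon] at h1
    have := h'.nonneg (z i)
    linarith
  · by_contra hcon
    have h1 := hsign i hi
    rw [ho.neg_one_pow, h'.zero_off _ hcon] at h1
    have := h.nonneg (z i)
    linarith

/-- The divided difference at the alternating nodes annihilates degree at most `δ` and equals `1` on
the next power. Its positive part lives on `S` and its negative part on `S'`. Divided by their
common mass `W`, they are weights of one point, with heights differing by `1 / W`. -/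
theorem Alternates.exists_weights {δ : ℕ} {S S' : Finset ℕ} (h : Alternates (δ + 2) S S') :
    ∃ (x : Fin δ → ℝ) (w w' : ℕ → ℝ), IsWeight δ S w x ∧ IsWeight δ S' w' x ∧
      ∑ i ∈ S', w' i * (i : ℝ) ^ (δ + 1) < ∑ i ∈ S, w i * (i : ℝ) ^ (δ + 1) := by
  obtain ⟨z, hz, hS, hS'⟩ := h
  set Z := (range (δ + 2)).image z with hZ
  have hcard : #Z = δ + 2 := hz.card_image
  let U : ℕ → ℝ := fun k => if k ∈ Z then divWeight Z k else 0
  have hUsum : ∀ f, ∑ k ∈ Z, U k * f k = dividedDifference f Z := fun f =>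
    sum_congr rfl fun k hk => by simp [U, hk]
  have hpow : ∀ j, j ≤ δ → ∑ k ∈ Z, U k * (k : ℝ) ^ j = 0 := by
    intro j hj
    rw [hUsum]
    simpa using dividedDifference_eval_eq_zero (Z := Z) (Q := X ^ j)
      (by rw [natDegree_X_pow, hcard]; omega)
  have hpow' : ∑ k ∈ Z, U k * (k : ℝ) ^ (δ + 1) = 1 := by
    rw [hUsum]
    have := dividedDifference_eval (Z := Z) (Q := X ^ (δ + 1)) (by simp [hcard])
    simpa [hcard] using this
  have hUS : ∀ k, k ∉ S → U k ≤ 0 := by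
    intro k hk
    by_cases hkZ : k ∈ Z
    · obtain ⟨i, hi, rfl⟩ := mem_image.1 hkZ
      rw [mem_range] at hi
      have h1 := hz.divWeight_sign hi
      rw [(Nat.not_even_iff_odd.1 fun he => hk (hS i hi he)).neg_one_pow] at h1
      simp only [U, hkZ, if_true]
      linarith
    · simp [U, hkZ]
  have hUS' : ∀ k, k ∉ S' → 0 ≤ U k := by
    intro k hk
    by_cases hkZ : k ∈ Z
    · obtain ⟨i, hi, rfl⟩ := mem_image.1 hkZ
      rw [mem_range] at hi
      have h1 := hz.divWeight_sign hi
      rw [(Nat.not_odd_iff_even.1 fun he => hk (hS' i hi he)).neg_one_pow] at h1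
      simp only [U, hkZ, if_true]
      linarith
    · simp [U, hkZ]
  have hUZ : ∀ k, k ∉ Z → U k = 0 := fun k hk => by simp [U, hk]
  set W := ∑ k ∈ Z, max (U k) 0 with hW
  have hWpos : 0 < W := by
    refine sum_pos' (fun k _ => le_max_right _ _) ⟨z 0, mem_image_of_mem _ (by simp), ?_⟩
    have h1 := hz.divWeight_sign (i := 0) (by omega)
    have h2 : z 0 ∈ Z := mem_image_of_mem _ (by simp)
    refine lt_max_of_lt_left ?_
    simpa [U, h2] using h1
  have hsplit : ∀ f : ℕ → ℝ, ∑ k ∈ Z, max (U k) 0 / W * f k -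
      ∑ k ∈ Z, max (-U k) 0 / W * f k = (∑ k ∈ Z, U k * f k) / W := by
    intro f
    rw [← sum_sub_distrib, sum_div]
    refine sum_congr rfl fun k _ => ?_
    rw [← sub_mul, ← sub_div]
    have : max (U k) 0 - max (-U k) 0 = U k := by
      rcases le_total (U k) 0 with h | h
      · rw [max_eq_right h, max_eq_left (by linarith)]; ring
      · rw [max_eq_left h, max_eq_right (by linarith)]; ring
    rw [this]
    ring
  have hone : ∑ k ∈ Z, max (U k) 0 / W = 1 := by
    rw [← sum_div, ← hW, div_self hWpos.ne']
  have hone' : ∑ k ∈ Z, max (-U k) 0 / W = 1 := by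
    have h1 := hsplit fun _ => 1
    have h2 := hpow 0 (by omega)
    simp only [pow_zero] at h2
    rw [h2] at h1
    simp only [mul_one, hone, zero_div] at h1
    linarith
  have hw : IsWeight δ Z (fun k => max (U k) 0 / W)
      (fun j => ∑ k ∈ Z, max (U k) 0 / W * (k : ℝ) ^ ((j : ℕ) + 1)) :=
    .of_sum_pow (fun k => div_nonneg (le_max_right _ _) hWpos.le)
      (fun k hk => by simp [hUZ k hk]) hone fun j => rfl
  have hw' : IsWeight δ Z (fun k => max (-U k) 0 / W)
      (fun j => ∑ k ∈ Z, max (U k) 0 / W * (k : ℝ) ^ ((j : ℕ) + 1)) :=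
    .of_sum_pow (fun k => div_nonneg (le_max_right _ _) hWpos.le)
      (fun k hk => by simp [hUZ k hk]) hone' fun j => by
        have h1 := hsplit fun k => (k : ℝ) ^ ((j : ℕ) + 1)
        rw [hpow _ (by omega), zero_div] at h1
        linarith
  have hwS := hw.of_support (B := S) fun k hk => by simp [max_eq_right (hUS k hk)]
  have hwS' := hw'.of_support (B := S') fun k hk => by
    simp [max_eq_right (neg_nonpos.2 (hUS' k hk))]
  refine ⟨_, _, _, hwS, hwS', ?_⟩
  rw [sum_mul_eq_of_support hwS.zero_off hw.zero_off,
    sum_mul_eq_of_support hwS'.zero_off hw'.zero_off]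
  have h1 := hsplit fun k => (k : ℝ) ^ (δ + 1)
  rw [hpow'] at h1
  have : 0 < 1 / W := by positivity
  linarith

/-- Two different weight vectors would make `A` alternate with itself, which takes `δ + 2` elements.
-/
theorem IsWeight.unique {δ : ℕ} {A : Finset ℕ} (hA : #A ≤ δ + 1) {w w' : ℕ → ℝ} {x : Fin δ → ℝ}
    (h : IsWeight δ A w x) (h' : IsWeight δ A w' x) : w = w' := by
  by_contra hne
  rcases le_total (∑ i ∈ A, w' i * (i : ℝ) ^ (δ + 1)) (∑ i ∈ A, w i * (i : ℝ) ^ (δ + 1)) with hle | hle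
  · have := (h.alternates h' hne hle).le_card
    omega
  · have := (h'.alternates h (Ne.symm hne) hle).le_card
    omega

/-! ### Heights of sections and comparison of triangulations -/

theorem IsWeight.init {δ : ℕ} {A : Finset ℕ} {w : ℕ → ℝ} {y : Fin (δ + 1) → ℝ}
    (h : IsWeight (δ + 1) A w y) : IsWeight δ A w (Fin.init y) :=
  ⟨h.nonneg, h.zero_off, h.sum_one, by
    rw [← h.sum_eq]
    ext j
    simp [Fin.init, momentPoint, Finset.sum_apply]⟩

theorem IsWeight.last {δ : ℕ} {A : Finset ℕ} {w : ℕ → ℝ} {y : Fin (δ + 1) → ℝ}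
    (h : IsWeight (δ + 1) A w y) : y (Fin.last δ) = ∑ i ∈ A, w i * (i : ℝ) ^ (δ + 1) := by
  rw [← h.sum_eq]
  simp [momentPoint, Finset.sum_apply]

theorem IsWeight.lift {δ : ℕ} {A : Finset ℕ} {w : ℕ → ℝ} {x : Fin δ → ℝ} (h : IsWeight δ A w x) :
    ∃ y : Fin (δ + 1) → ℝ, IsWeight (δ + 1) A w y ∧ Fin.init y = x := by
  refine ⟨_, ⟨h.nonneg, h.zero_off, h.sum_one, rfl⟩, ?_⟩
  rw [← h.sum_eq]
  ext j
  simp [Fin.init, momentPoint, Finset.sum_apply]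

/-- `plSection` is an arbitrary choice among the lifts of `x`; uniqueness of the weights over `x` is
what pins it down. -/
theorem sectionHeight_eq {δ : ℕ} {K : Finset (Finset ℕ)} {x : Fin δ → ℝ} {S : Finset ℕ}
    {w : ℕ → ℝ} (hS : S ∈ K) (hw : IsWeight δ S w x)
    (huniq : ∀ S' ∈ K, ∀ w', IsWeight δ S' w' x → w' = w) :
    sectionHeight δ K x = ∑ i ∈ S, w i * (i : ℝ) ^ (δ + 1) := by
  have hex : ∃ y, (∃ S ∈ K, y ∈ geomSimplex (δ + 1) S) ∧ Fin.init y = x := by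
    obtain ⟨y, hy, hyx⟩ := hw.lift
    exact ⟨y, ⟨S, hS, mem_geomSimplex_iff.2 ⟨w, hy⟩⟩, hyx⟩
  obtain ⟨⟨S', hS', hy⟩, hyx⟩ := Classical.epsilon_spec hex
  obtain ⟨w', hw'⟩ := mem_geomSimplex_iff.1 hy
  have h1 := hw'.init
  rw [hyx] at h1
  obtain rfl := huniq S' hS' w' h1
  rw [sectionHeight, plSection, hw'.last]
  exact sum_mul_eq_of_support hw'.zero_off hw.zero_off _

theorem sectionHeight_singleton {δ : ℕ} {A : Finset ℕ} (hA : #A ≤ δ + 1) {w : ℕ → ℝ}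
    {x : Fin δ → ℝ} (hw : IsWeight δ A w x) :
    sectionHeight δ {A} x = ∑ i ∈ A, w i * (i : ℝ) ^ (δ + 1) :=
  sectionHeight_eq (mem_singleton_self A) hw fun S' hS' w' hw' => by
    rw [mem_singleton.1 hS'] at hw'
    exact hw'.unique hA hw

namespace Triangulation

variable {m δ : ℕ} (T T' : Triangulation m δ)

/-- The point lies in the simplex on the common vertices. Its weights there serve for both
simplices, each of which has unique weights. -/
theorem weight_unique {S S' : Finset ℕ} (hS : S ∈ T.simplices) (hS' : S' ∈ T.simplices)
    {w w' : ℕ → ℝ} {x : Fin δ → ℝ} (hw : IsWeight δ S w x) (hw' : IsWeight δ S' w' x) :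
    w = w' := by
  have hx : x ∈ geomSimplex δ (S ∩ S') := by
    rw [← T.inter S hS S' hS']
    exact ⟨mem_geomSimplex_iff.2 ⟨w, hw⟩, mem_geomSimplex_iff.2 ⟨w', hw'⟩⟩
  obtain ⟨v, hv⟩ := mem_geomSimplex_iff.1 hx
  rw [hw.unique (T.card_eq S hS).le (hv.mono inter_subset_left),
    hw'.unique (T.card_eq S' hS').le (hv.mono inter_subset_right)]

theorem exists_weight {x : Fin δ → ℝ} (hx : x ∈ cyclicPolytope m δ) :
    ∃ S ∈ T.simplices, ∃ w, IsWeight δ S w x := by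
  rw [← T.cover] at hx
  simp only [Set.mem_iUnion] at hx
  obtain ⟨S, hS, hx⟩ := hx
  exact ⟨S, hS, mem_geomSimplex_iff.1 hx⟩

theorem sectionHeight_eq {S : Finset ℕ} (hS : S ∈ T.simplices) {w : ℕ → ℝ} {x : Fin δ → ℝ}
    (hw : IsWeight δ S w x) :
    sectionHeight δ T.simplices x = ∑ i ∈ S, w i * (i : ℝ) ^ (δ + 1) :=
  _root_.sectionHeight_eq hS hw fun _ hS' _ hw' => T.weight_unique hS' hS hw' hw

theorem mem_cyclicPolytope {S : Finset ℕ} (hS : S ∈ T.simplices) {w : ℕ → ℝ} {x : Fin δ → ℝ}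
    (hw : IsWeight δ S w x) : x ∈ cyclicPolytope m δ :=
  mem_geomSimplex_iff.2 ⟨w, hw.mono (T.vertices_subset S hS)⟩

theorem not_alternates {S S' : Finset ℕ} (hS : S ∈ T.simplices) (hS' : S' ∈ T.simplices) :
    ¬ Alternates (δ + 2) S S' := by
  intro h
  obtain ⟨x, w, w', hw, hw', hlt⟩ := h.exists_weights
  obtain rfl := T.weight_unique hS hS' hw hw'
  rw [sum_mul_eq_of_support hw'.zero_off hw.zero_off] at hlt
  exact lt_irrefl _ hlt

theorem submerges_iff {A : Finset ℕ} (hA : #A ≤ δ + 1) (hAm : A ⊆ Icc 1 m) :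
    T.Submerges A ↔ ∀ S ∈ T.simplices, ¬ Alternates (δ + 2) A S := by
  constructor
  · intro h S hS halt
    obtain ⟨x, w, w', hw, hw', hlt⟩ := halt.exists_weights
    have := h x (mem_geomSimplex_iff.2 ⟨w, hw⟩)
    rw [sectionHeight_singleton hA hw, T.sectionHeight_eq hS hw'] at this
    linarith
  · intro h x hx
    obtain ⟨w, hw⟩ := mem_geomSimplex_iff.1 hx
    obtain ⟨S, hS, w', hw'⟩ := T.exists_weight (mem_geomSimplex_iff.2 ⟨w, hw.mono hAm⟩)
    rw [sectionHeight_singleton hA hw, T.sectionHeight_eq hS hw']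
    by_contra hcon
    refine h S hS (hw.alternates hw' ?_ (not_le.1 hcon).le)
    rintro rfl
    exact hcon (sum_mul_eq_of_support hw.zero_off hw'.zero_off _).le

/-- An alternation produces a point where `T` is strictly higher. At such a point, conversely, the
two weight vectors differ, hence alternate. -/
theorem le_iff : T ≤ T' ↔
    ∀ S ∈ T.simplices, ∀ S' ∈ T'.simplices, ¬ Alternates (δ + 2) S S' := by
  have hdef : T ≤ T' ↔ ∀ x ∈ cyclicPolytope m δ,
      sectionHeight δ T.simplices x ≤ sectionHeight δ T'.simplices x :=
    ⟨fun h x hx => h ⟨x, hx⟩, fun h x => h x x.2⟩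
  rw [hdef]
  constructor
  · intro h S hS S' hS' halt
    obtain ⟨x, w, w', hw, hw', hlt⟩ := halt.exists_weights
    have := h x (T.mem_cyclicPolytope hS hw)
    rw [T.sectionHeight_eq hS hw, T'.sectionHeight_eq hS' hw'] at this
    linarith
  · intro h x hx
    obtain ⟨S, hS, w, hw⟩ := T.exists_weight hx
    obtain ⟨S', hS', w', hw'⟩ := T'.exists_weight hx
    rw [T.sectionHeight_eq hS hw, T'.sectionHeight_eq hS' hw']
    by_contra hcon
    refine h S hS S' hS' (hw.alternates hw' ?_ (not_le.1 hcon).le)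
    rintro rfl
    exact hcon (sum_mul_eq_of_support hw.zero_off hw'.zero_off _).le

end Triangulation

/-- The weights of the barycentre of `A`. -/
theorem exists_isWeight_pos (δ : ℕ) {A : Finset ℕ} (hA : A.Nonempty) :
    ∃ w x, IsWeight δ A w x ∧ ∀ i ∈ A, 0 < w i := by
  have hc : (0 : ℝ) < #A := by exact_mod_cast hA.card_pos
  refine ⟨fun i => if i ∈ A then (#A : ℝ)⁻¹ else 0, _, ⟨?_, ?_, ?_, rfl⟩, ?_⟩
  · intro i
    split_ifs <;> positivity
  · intro i hi
    simp [hi]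
  · rw [sum_congr rfl fun i hi => if_pos hi]
    simp [hc.ne']
  · intro i hi
    simp [hi, hc]

namespace Triangulation

variable {m δ : ℕ} (T T' : Triangulation m δ)

/-- The barycentre of `S` lies in some simplex `S'` of `T'`. Different weights there would give an
alternation one way or the other, against `h` or `h'`; equal weights put all of `S` into `S'`. -/
theorem simplices_subset_of_le_of_le (h : T ≤ T') (h' : T' ≤ T) : T.simplices ⊆ T'.simplices := by
  intro S hS
  obtain ⟨w, x, hw, hpos⟩ := exists_isWeight_pos δ (A := S)
    (card_pos.1 (by rw [T.card_eq S hS]; omega))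
  obtain ⟨S', hS', w', hw'⟩ := T'.exists_weight (T.mem_cyclicPolytope hS hw)
  have hww : w = w' := by
    by_contra hne
    rcases le_total (∑ i ∈ S', w' i * (i : ℝ) ^ (δ + 1)) (∑ i ∈ S, w i * (i : ℝ) ^ (δ + 1))
      with hle | hle
    · exact (T.le_iff T').1 h S hS S' hS' (hw.alternates hw' hne hle)
    · exact (T'.le_iff T).1 h' S' hS' S hS (hw'.alternates hw (Ne.symm hne) hle)
  subst hww
  have hsub : S ⊆ S' := fun i hi => by
    by_contra hcon
    exact (hpos i hi).ne' (hw'.zero_off i hcon)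
  rwa [eq_of_subset_of_card_le hsub (by rw [T.card_eq S hS, T'.card_eq S' hS'])]

theorem eq_of_le_of_le (h : T ≤ T') (h' : T' ≤ T) : T = T' :=
  Triangulation.ext ((T.simplices_subset_of_le_of_le T' h h').antisymm
    (T'.simplices_subset_of_le_of_le T h' h))

end Triangulation

/-! ### Separated sets and alternating sequences -/

theorem mem_innerSeparated {m d : ℕ} {A : Finset ℕ} : A ∈ innerSeparated m d ↔
    A ⊆ Icc 1 m ∧ #A = d + 1 ∧ (∀ a ∈ A, ∀ b ∈ A, a < b → a + 2 ≤ b) ∧ 1 ∉ A ∧ m ∉ A := by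
  simp [innerSeparated, and_assoc]

theorem IsDecreasing.subseq {n n' c : ℕ} {z : ℕ → ℕ} (hz : IsDecreasing n z)
    (h : ∀ i < n', 2 * i + c < n) : IsDecreasing n' fun i => z (2 * i + c) :=
  fun j hj i hi => hz _ (h j hj) _ (by omega)

theorem IsDecreasing.separated {n n' c : ℕ} {z : ℕ → ℕ} (hz : IsDecreasing n z)
    (h : ∀ i < n', 2 * i + c < n) :
    ∀ a ∈ (range n').image (fun i => z (2 * i + c)),
      ∀ b ∈ (range n').image (fun i => z (2 * i + c)), a < b → a + 2 ≤ b := by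
  intro a ha b hb hab
  obtain ⟨i, hi, rfl⟩ := mem_image.1 ha
  obtain ⟨j, hj, rfl⟩ := mem_image.1 hb
  rw [mem_range] at hi hj
  have hji : j < i := by
    by_contra hcon
    rcases (not_lt.1 hcon).eq_or_lt with rfl | h'
    · exact lt_irrefl _ hab
    · have := (hz.subseq h) j hj i h'
      dsimp only at this hab
      omega
  have h1 := hz (2 * i + c) (h i hi) (2 * j + c + 1) (by omega)
  have h2 := hz (2 * j + c + 1) (by have := h i hi; omega) (2 * j + c) (by omega)
  omega

/-- An odd term lies strictly between consecutive even ones, which forces gaps of two, and one more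
lies below them all, which excludes `1`. -/
theorem IsDecreasing.image_even_mem_innerSeparated {m d : ℕ} {z : ℕ → ℕ}
    (hz : IsDecreasing (2 * d + 2) z) (hm : ∀ i < 2 * d + 2, z i ∈ Icc 1 m) :
    (range (d + 1)).image (fun i => z (2 * i)) ∈ innerSeparated (m + 1) d := by
  have hc : ∀ i < d + 1, 2 * i + 0 < 2 * d + 2 := by omega
  refine mem_innerSeparated.2 ⟨?_, ?_, hz.separated hc, ?_, ?_⟩
  · intro k hk
    obtain ⟨i, hi, rfl⟩ := mem_image.1 hk
    have := mem_Icc.1 (hm (2 * i) (by have := mem_range.1 hi; omega))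
    exact mem_Icc.2 (by omega)
  · exact (hz.subseq hc).card_image
  · intro hk
    obtain ⟨i, hi, hk⟩ := mem_image.1 hk
    rw [mem_range] at hi
    have h1 := hz (2 * i + 1) (by omega) (2 * i) (by omega)
    have h2 := mem_Icc.1 (hm (2 * i + 1) (by omega))
    omega
  · intro hk
    obtain ⟨i, hi, hk⟩ := mem_image.1 hk
    rw [mem_range] at hi
    have h2 := mem_Icc.1 (hm (2 * i) (by omega))
    omega

theorem IsDecreasing.image_odd_mem_innerSeparated {m d : ℕ} {z : ℕ → ℕ}
    (hz : IsDecreasing (2 * d + 3) z) (hm : ∀ i < 2 * d + 3, z i ∈ Icc 1 m) :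
    (range (d + 1)).image (fun i => z (2 * i + 1)) ∈ innerSeparated m d := by
  have hc : ∀ i < d + 1, 2 * i + 1 < 2 * d + 3 := by omega
  refine mem_innerSeparated.2 ⟨?_, ?_, hz.separated hc, ?_, ?_⟩
  · intro k hk
    obtain ⟨i, hi, rfl⟩ := mem_image.1 hk
    exact hm _ (by have := mem_range.1 hi; omega)
  · exact (hz.subseq hc).card_image
  · intro hk
    obtain ⟨i, hi, hk⟩ := mem_image.1 hk
    rw [mem_range] at hi
    have h1 := hz (2 * i + 2) (by omega) (2 * i + 1) (by omega)
    have h2 := mem_Icc.1 (hm (2 * i + 2) (by omega))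
    omega
  · intro hk
    obtain ⟨i, hi, hk⟩ := mem_image.1 hk
    rw [mem_range] at hi
    have h1 := hz (2 * i + 1) (by omega) (2 * i) (by omega)
    have h2 := mem_Icc.1 (hm (2 * i) (by omega))
    omega

/-- The value `0` from `n` on supplies the closing term in `exists_isDecreasing_odd`. -/
theorem exists_isDecreasing_image_eq {n : ℕ} {A : Finset ℕ} (hA : #A = n) :
    ∃ a : ℕ → ℕ, IsDecreasing n a ∧ (range n).image a = A ∧ ∀ i, n ≤ i → a i = 0 := by
  let e := A.orderEmbOfFin hA
  refine ⟨fun i => if h : i < n then e ⟨n - 1 - i, by omega⟩ else 0, ?_, ?_, ?_⟩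
  · intro j hj i hi
    have hin : i < n := by omega
    simp only [hj, hin, dif_pos]
    exact e.strictMono (by simp only [Fin.mk_lt_mk]; omega)
  · ext k
    simp only [mem_image, mem_range]
    constructor
    · rintro ⟨i, hi, rfl⟩
      simp only [hi, dif_pos]
      exact A.orderEmbOfFin_mem hA _
    · intro hk
      have : k ∈ Set.range e := by rw [A.range_orderEmbOfFin hA]; exact hk
      obtain ⟨i, rfl⟩ := this
      refine ⟨n - 1 - i, by omega, ?_⟩
      have h1 : n - 1 - (i : ℕ) < n := by omega
      have h2 : n - 1 - (n - 1 - (i : ℕ)) = i := by omega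
      simp only [h1, dif_pos, h2]
  · intro i hi
    simp [hi.not_gt]

/-- `A` and its translate `A - 1` alternate. -/
theorem exists_isDecreasing_even {m d : ℕ} {A : Finset ℕ} (hA : A ∈ innerSeparated (m + 1) d) :
    ∃ z, IsDecreasing (2 * d + 2) z ∧ (∀ i < 2 * d + 2, z i ∈ Icc 1 m) ∧
      (∀ i < 2 * d + 2, Even i → z i ∈ A) ∧ (∀ i < 2 * d + 2, Odd i → z i + 1 ∈ A) ∧
      (range (2 * d + 2)).image z = A ∪ A.image (· - 1) := by
  obtain ⟨hAm, hcard, hsep, h1, hm⟩ := mem_innerSeparated.1 hA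
  obtain ⟨a, ha, hAa, _⟩ := exists_isDecreasing_image_eq hcard
  have haA : ∀ i < d + 1, a i ∈ A := fun i hi => hAa ▸ mem_image_of_mem a (mem_range.2 hi)
  have hA2 : ∀ k ∈ A, 2 ≤ k ∧ k ≤ m := by
    intro k hk
    have h2 := mem_Icc.1 (hAm hk)
    have h3 : k ≠ 1 := fun h => h1 (h ▸ hk)
    have h4 : k ≠ m + 1 := fun h => hm (h ▸ hk)
    omega
  have hz : ∀ i < 2 * d + 2, a (i / 2) ∈ A := fun i hi => haA _ (by omega)
  -- The sequence is `a 0, a 0 - 1, a 1, a 1 - 1, …`.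
  refine ⟨fun i => a (i / 2) - i % 2, ?_, ?_, ?_, ?_, ?_⟩
  · intro j hj i hi
    have h2 := hA2 _ (hz j hj)
    rcases (Nat.div_le_div_right (c := 2) hi.le).eq_or_lt with h | h
    · dsimp only
      rw [h]
      omega
    · have h3 := ha (j / 2) (by omega) (i / 2) h
      have h4 := hsep _ (hz j hj) _ (hz i (by omega)) h3
      dsimp only
      omega
  · intro i hi
    have h2 := hA2 _ (hz i hi)
    dsimp only
    exact mem_Icc.2 (by omega)
  · intro i hi he
    dsimp only
    rw [Nat.even_iff.1 he]
    exact hz i hi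
  · intro i hi ho
    have h2 := hA2 _ (hz i hi)
    dsimp only
    rw [Nat.odd_iff.1 ho, Nat.sub_add_cancel (by omega)]
    exact hz i hi
  · ext k
    simp only [mem_image, mem_union, mem_range]
    constructor
    · rintro ⟨i, hi, rfl⟩
      rcases Nat.mod_two_eq_zero_or_one i with h | h
      · left; rw [h]; exact hz i hi
      · right; rw [h]; exact ⟨_, hz i hi, rfl⟩
    · rintro (hk | ⟨k, hk, rfl⟩)
      · obtain ⟨i, hi, rfl⟩ := mem_image.1 (hAa ▸ hk)
        have := mem_range.1 hi
        exact ⟨2 * i, by omega, by simp⟩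
      · obtain ⟨i, hi, rfl⟩ := mem_image.1 (hAa ▸ hk)
        have := mem_range.1 hi
        refine ⟨2 * i + 1, by omega, ?_⟩
        rw [show (2 * i + 1) / 2 = i by omega, show (2 * i + 1) % 2 = 1 by omega]

/-- `{1} ∪ (B + 1)` and `B` alternate. -/
theorem exists_isDecreasing_odd {m d : ℕ} {B : Finset ℕ} (hB : B ∈ innerSeparated m d) :
    ∃ z, IsDecreasing (2 * d + 3) z ∧ (∀ i < 2 * d + 3, z i ∈ Icc 1 m) ∧
      (∀ i < 2 * d + 3, Odd i → z i ∈ B) ∧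
      (range (2 * d + 3)).image z = insert 1 (B ∪ B.image (· + 1)) := by
  obtain ⟨hBm, hcard, hsep, h1, hm⟩ := mem_innerSeparated.1 hB
  obtain ⟨b, hb, hBb, hb0⟩ := exists_isDecreasing_image_eq hcard
  have hbB : ∀ i < d + 1, b i ∈ B := fun i hi => hBb ▸ mem_image_of_mem b (mem_range.2 hi)
  have hB2 : ∀ k ∈ B, 2 ≤ k ∧ k + 1 ≤ m := by
    intro k hk
    have h2 := mem_Icc.1 (hBm hk)
    have h3 : k ≠ 1 := fun h => h1 (h ▸ hk)
    have h4 : k ≠ m := fun h => hm (h ▸ hk)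
    omega
  have hz : ∀ i < 2 * d + 2, b (i / 2) ∈ B := fun i hi => hbB _ (by omega)
  -- The sequence will be `b 0 + 1, b 0, b 1 + 1, b 1, …`; at its last index the default value `0`
  -- of `b` yields the term `1`.
  have hlast : b ((2 * d + 2) / 2) = 0 := hb0 _ (by omega)
  have hm1 : 1 ≤ m := by
    have := hB2 _ (hbB 0 (by omega))
    omega
  refine ⟨fun i => b (i / 2) + (1 - i % 2), ?_, ?_, ?_, ?_⟩
  · intro j hj i hi
    have h2 := hB2 _ (hz i (by omega))
    dsimp only
    by_cases hj' : j = 2 * d + 2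
    · subst hj'
      rw [hlast]
      omega
    · rcases (Nat.div_le_div_right (c := 2) hi.le).eq_or_lt with h | h
      · rw [h]
        omega
      · have h3 := hb (j / 2) (by omega) (i / 2) h
        have h4 := hsep _ (hz j (by omega)) _ (hz i (by omega)) h3
        omega
  · intro i hi
    dsimp only
    by_cases hi' : i = 2 * d + 2
    · subst hi'
      rw [hlast]
      exact mem_Icc.2 (by omega)
    · have h2 := hB2 _ (hz i (by omega))
      exact mem_Icc.2 (by omega)
  · intro i hi ho
    have := Nat.odd_iff.1 ho
    dsimp only
    rw [this]
    exact hz i (by omega)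
  · ext k
    simp only [mem_image, mem_union, mem_range, mem_insert]
    constructor
    · rintro ⟨i, hi, rfl⟩
      by_cases hi' : i = 2 * d + 2
      · left
        subst hi'
        rw [hlast]
        omega
      · right
        rcases Nat.mod_two_eq_zero_or_one i with h | h
        · right; rw [h]; exact ⟨_, hz i (by omega), rfl⟩
        · left; rw [h]; exact hz i (by omega)
    · rintro (rfl | hk | ⟨k, hk, rfl⟩)
      · exact ⟨2 * d + 2, by omega, by rw [hlast]; omega⟩
      · obtain ⟨i, hi, rfl⟩ := mem_image.1 (hBb ▸ hk)
        have := mem_range.1 hi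
        refine ⟨2 * i + 1, by omega, ?_⟩
        rw [show (2 * i + 1) / 2 = i by omega, show (2 * i + 1) % 2 = 1 by omega]
        rfl
      · obtain ⟨i, hi, rfl⟩ := mem_image.1 (hBb ▸ hk)
        have := mem_range.1 hi
        exact ⟨2 * i, by omega, by simp⟩

/-! ### Completion to sets satisfying Gale's evenness condition -/

/-- A set of at most `k` elements of `{0, …, n - 1}`, or of `k + 1` elements of which two are
consecutive, is covered by `k` disjoint pairs of consecutive elements. -/
theorem exists_even_completion (n : ℕ) : ∀ (k : ℕ) (A : Finset ℕ), A ⊆ range n →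
    (#A ≤ k ∨ #A ≤ k + 1 ∧ ∃ a ∈ A, a + 1 ∈ A) → 2 * k ≤ n →
    ∃ S, A ⊆ S ∧ S ⊆ range n ∧ #S = 2 * k ∧ ∀ j < n, 0 ≤ ∏ s ∈ S, ((j : ℝ) - s) := by
  induction n using Nat.strong_induction_on with
  | _ n ih =>
  intro k A hA hcard hk
  rcases Nat.eq_zero_or_pos k with rfl | hkpos
  · have hA0 : A = ∅ := by
      rcases hcard with h | ⟨h, a, ha, ha'⟩
      · exact card_eq_zero.1 (by omega)
      · have : 1 < #A := one_lt_card.2 ⟨a, ha, a + 1, ha', by omega⟩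
        omega
    exact ⟨∅, by simp [hA0], by simp, by simp, by simp⟩
  rcases hk.eq_or_lt with hkn | hkn
  · refine ⟨range n, hA, Subset.rfl, by simp [hkn], fun j hj => ?_⟩
    rw [prod_eq_zero (mem_range.2 hj) (sub_self _)]
  -- If `n - 1 ∈ A`, one pair is spent on `{n - 2, n - 1}`. When `n - 2` is also in `A`, this pair
  -- absorbs the surplus element; otherwise the two consecutive elements survive below.
  by_cases hn : n - 1 ∈ A
  · have hsub : A \ {n - 1, n - 2} ⊆ range (n - 2) := by
      intro a ha
      simp only [mem_sdiff, mem_insert, mem_singleton, not_or] at ha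
      have := mem_range.1 (hA ha.1)
      exact mem_range.2 (by omega)
    have hinter : #(A ∩ {n - 1, n - 2}) + #(A \ {n - 1, n - 2}) = #A :=
      card_inter_add_card_sdiff _ _
    have hone : 1 ≤ #(A ∩ {n - 1, n - 2}) := card_pos.2 ⟨n - 1, by simp [hn]⟩
    obtain ⟨S, hAS, hSn, hS, hprod⟩ := ih (n - 2) (by omega) (k - 1) _ hsub (by
      rcases hcard with h | ⟨h, a, ha, ha'⟩
      · left; omega
      · by_cases hn2 : n - 2 ∈ A
        · left
          have : 1 < #(A ∩ {n - 1, n - 2}) :=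
            one_lt_card.2 ⟨n - 1, by simp [hn], n - 2, by simp [hn2], by omega⟩
          omega
        · right
          have h1 : a ≠ n - 2 := fun h => hn2 (h ▸ ha)
          have h2 : a + 1 ≠ n - 2 := fun h => hn2 (h ▸ ha')
          have h3 := mem_range.1 (hA ha')
          refine ⟨by omega, a, ?_, ?_⟩
          · simp only [mem_sdiff, ha, mem_insert, mem_singleton, true_and]
            omega
          · simp only [mem_sdiff, ha', mem_insert, mem_singleton, true_and]
            omega) (by omega)
    have hn2S : n - 2 ∉ S := fun h => by simpa using hSn h
    have hn1S : n - 1 ∉ insert (n - 2) S := by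
      intro h
      rcases mem_insert.1 h with h | h
      · omega
      · have := mem_range.1 (hSn h)
        omega
    refine ⟨insert (n - 1) (insert (n - 2) S), ?_, ?_, ?_, ?_⟩
    · intro a ha
      by_cases h : a ∈ ({n - 1, n - 2} : Finset ℕ)
      · simp only [mem_insert, mem_singleton] at h ⊢
        tauto
      · exact mem_insert_of_mem (mem_insert_of_mem (hAS (mem_sdiff.2 ⟨ha, h⟩)))
    · intro a ha
      rcases mem_insert.1 ha with rfl | ha
      · exact mem_range.2 (by omega)
      · rcases mem_insert.1 ha with rfl | ha
        · exact mem_range.2 (by omega)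
        · have := mem_range.1 (hSn ha)
          exact mem_range.2 (by omega)
    · rw [card_insert_of_notMem hn1S, card_insert_of_notMem hn2S, hS]
      omega
    · intro j hj
      rw [prod_insert hn1S, prod_insert hn2S, ← mul_assoc]
      rcases lt_or_ge j (n - 2) with h | h
      · refine mul_nonneg (mul_nonneg_of_nonpos_of_nonpos ?_ ?_) (hprod j h)
        · exact sub_nonpos.2 (by exact_mod_cast (by omega : j ≤ n - 1))
        · exact sub_nonpos.2 (by exact_mod_cast h.le)
      · rcases (by omega : j = n - 2 ∨ j = n - 1) with rfl | rfl <;> simp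
  · obtain ⟨S, hAS, hSn, hS, hprod⟩ := ih (n - 1) (by omega) k A (by
      intro a ha
      have h1 := mem_range.1 (hA ha)
      have h2 : a ≠ n - 1 := fun h => hn (h ▸ ha)
      exact mem_range.2 (by omega)) hcard (by omega)
    refine ⟨S, hAS, fun a ha => ?_, hS, fun j hj => ?_⟩
    · have := mem_range.1 (hSn ha)
      exact mem_range.2 (by omega)
    · rcases lt_or_ge j (n - 1) with h | h
      · exact hprod j h
      · refine prod_nonneg fun s hs => sub_nonneg.2 ?_
        have := mem_range.1 (hSn hs)
        exact_mod_cast (by omega : s ≤ j)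

/-- An auxiliary vertex `0` turns `1 ∈ A` into a consecutive pair `{0, 1}`. Completing `insert 0 A`
by `d + 1` pairs and deleting `0` leaves `2d + 1` vertices and removes only the positive factor `j`
from the product. -/
theorem exists_lower_completion {m d : ℕ} (hm : 2 * d + 1 ≤ m) {A : Finset ℕ} (hA : A ⊆ Icc 1 m)
    (hcard : #A = d + 1) (h : 1 ∈ A ∨ ∃ a ∈ A, a + 1 ∈ A) :
    ∃ S, A ⊆ S ∧ S ⊆ Icc 1 m ∧ #S = 2 * d + 1 ∧ ∀ j ∈ Icc 1 m, 0 ≤ ∏ s ∈ S, ((j : ℝ) - s) := by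
  have h0 : 0 ∉ A := fun h => by simpa using hA h
  obtain ⟨S, hAS, hSm, hS, hprod⟩ := exists_even_completion (m + 1) (d + 1) (insert 0 A) (by
      intro a ha
      rcases mem_insert.1 ha with rfl | ha
      · simp
      · have := mem_Icc.1 (hA ha)
        exact mem_range.2 (by omega)) (by
      right
      refine ⟨by rw [card_insert_of_notMem h0]; omega, ?_⟩
      rcases h with h | ⟨a, ha, ha'⟩
      · exact ⟨0, mem_insert_self _ _, mem_insert_of_mem h⟩
      · exact ⟨a, mem_insert_of_mem ha, mem_insert_of_mem ha'⟩) (by omega)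
  have h0S : 0 ∈ S := hAS (mem_insert_self _ _)
  refine ⟨S.erase 0, ?_, ?_, ?_, ?_⟩
  · exact fun a ha => mem_erase.2 ⟨fun h => h0 (h ▸ ha), hAS (mem_insert_of_mem ha)⟩
  · intro a ha
    obtain ⟨ha0, ha⟩ := mem_erase.1 ha
    have := mem_range.1 (hSm ha)
    exact mem_Icc.2 (by omega)
  · rw [card_erase_of_mem h0S, hS]
    omega
  · intro j hj
    obtain ⟨hj1, hj2⟩ := mem_Icc.1 hj
    have h1 := hprod j (by omega)
    rw [← mul_prod_erase S _ h0S] at h1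
    refine nonneg_of_mul_nonneg_right h1 ?_
    have : (0 : ℝ) < j := by exact_mod_cast hj1
    simpa using this

/-- The reflection `a ↦ m + 1 - a` moves `m` to `1`, and reverses the sign of a product of `2d + 1`
factors. -/
theorem exists_upper_completion {m d : ℕ} (hm : 2 * d + 1 ≤ m) {A : Finset ℕ} (hA : A ⊆ Icc 1 m)
    (hcard : #A = d + 1) (h : m ∈ A) :
    ∃ S, A ⊆ S ∧ S ⊆ Icc 1 m ∧ #S = 2 * d + 1 ∧ ∀ j ∈ Icc 1 m, ∏ s ∈ S, ((j : ℝ) - s) ≤ 0 := by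
  have hinj : Set.InjOn (fun a => m + 1 - a) (Icc 1 m : Finset ℕ) := by
    intro a ha b hb hab
    simp only [coe_Icc, Set.mem_Icc] at ha hb
    dsimp only at hab
    omega
  have hmaps : ∀ a ∈ Icc 1 m, m + 1 - a ∈ Icc 1 m := by
    intro a ha
    simp only [mem_Icc] at ha ⊢
    omega
  obtain ⟨S, hAS, hSm, hS, hprod⟩ := exists_lower_completion hm
    (A := A.image fun a => m + 1 - a)
    (by
      intro a ha
      obtain ⟨b, hb, rfl⟩ := mem_image.1 ha
      exact hmaps b (hA hb))
    (by rw [card_image_of_injOn (hinj.mono (coe_subset.2 hA)), hcard])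
    (Or.inl (mem_image.2 ⟨m, h, by omega⟩))
  have hinjS := hinj.mono (coe_subset.2 hSm)
  refine ⟨S.image fun a => m + 1 - a, ?_, ?_, ?_, ?_⟩
  · intro a ha
    have := mem_Icc.1 (hA ha)
    exact mem_image.2 ⟨_, hAS (mem_image_of_mem _ ha), by omega⟩
  · intro a ha
    obtain ⟨b, hb, rfl⟩ := mem_image.1 ha
    exact hmaps b (hSm hb)
  · rw [card_image_of_injOn hinjS, hS]
  · intro j hj
    have h1 := hprod _ (hmaps j hj)
    have hj' := mem_Icc.1 hj
    rw [prod_image hinjS]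
    have h2 : ∏ s ∈ S, ((j : ℝ) - ((m + 1 - s : ℕ) : ℝ)) =
        ∏ s ∈ S, (-1) * (((m + 1 - j : ℕ) : ℝ) - s) := by
      refine prod_congr rfl fun s hs => ?_
      have := mem_Icc.1 (hSm hs)
      rw [Nat.cast_sub (by omega), Nat.cast_sub (by omega)]
      push_cast
      ring
    rw [h2, prod_mul_distrib, prod_const, hS, Odd.neg_one_pow ⟨d, rfl⟩]
    linarith

/-! ### Counting separated sets -/

/-- The `k`-subsets of `{0, …, n - 1}` without two consecutive elements. -/
def separatedSets (n k : ℕ) : Finset (Finset ℕ) :=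
  (powersetCard k (range n)).filter fun A => ∀ a ∈ A, ∀ b ∈ A, a < b → a + 2 ≤ b

theorem mem_separatedSets {n k : ℕ} {A : Finset ℕ} : A ∈ separatedSets n k ↔
    A ⊆ range n ∧ #A = k ∧ ∀ a ∈ A, ∀ b ∈ A, a < b → a + 2 ≤ b := by
  simp [separatedSets, and_assoc]

/-- The two terms count the sets without and with `n + 1`; in the latter `n` is excluded, so the
other elements are below `n`. -/
theorem card_separatedSets_add_two (n k : ℕ) : #(separatedSets (n + 2) (k + 1)) =
    #(separatedSets (n + 1) (k + 1)) + #(separatedSets n k) := by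
  rw [← card_filter_add_card_filter_not (s := separatedSets (n + 2) (k + 1)) fun A => n + 1 ∉ A]
  congr 1
  · congr 1
    ext A
    simp only [mem_filter, mem_separatedSets]
    constructor
    · rintro ⟨⟨hA, hc, hs⟩, hn⟩
      refine ⟨fun a ha => ?_, hc, hs⟩
      have h1 := mem_range.1 (hA ha)
      have h2 : a ≠ n + 1 := fun h => hn (h ▸ ha)
      exact mem_range.2 (by omega)
    · rintro ⟨hA, hc, hs⟩
      refine ⟨⟨fun a ha => ?_, hc, hs⟩, fun h => ?_⟩
      · have := mem_range.1 (hA ha)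
        exact mem_range.2 (by omega)
      · have := mem_range.1 (hA h)
        omega
  · refine card_nbij' (fun A => A.erase (n + 1)) (fun A => insert (n + 1) A) ?_ ?_ ?_ ?_
    · intro A hA
      simp only [coe_filter, mem_separatedSets, not_not, Set.mem_ofPred_eq] at hA
      obtain ⟨⟨hA, hc, hs⟩, hn⟩ := hA
      refine mem_separatedSets.2 ⟨fun a ha => ?_, by rw [card_erase_of_mem hn, hc]; rfl,
        fun a ha b hb => hs a (mem_of_mem_erase ha) b (mem_of_mem_erase hb)⟩
      obtain ⟨hne, ha⟩ := mem_erase.1 ha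
      have h1 := mem_range.1 (hA ha)
      have h2 := hs a ha (n + 1) hn (by omega)
      exact mem_range.2 (by omega)
    · intro A hA
      obtain ⟨hA, hc, hs⟩ := mem_separatedSets.1 hA
      have hlt : ∀ a ∈ A, a < n := fun a ha => mem_range.1 (hA ha)
      have hn : n + 1 ∉ A := fun h => by have := hlt _ h; omega
      simp only [coe_filter, mem_separatedSets, not_not, Set.mem_ofPred_eq]
      refine ⟨⟨fun a ha => ?_, by rw [card_insert_of_notMem hn, hc], ?_⟩, mem_insert_self _ _⟩
      · rcases mem_insert.1 ha with rfl | ha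
        · exact mem_range.2 (by omega)
        · exact mem_range.2 (by have := hlt a ha; omega)
      · intro a ha b hb hab
        rcases mem_insert.1 ha with rfl | ha
        · rcases mem_insert.1 hb with rfl | hb
          · omega
          · have := hlt b hb
            omega
        · rcases mem_insert.1 hb with rfl | hb
          · have := hlt a ha
            omega
          · exact hs a ha b hb hab
    · intro A hA
      simp only [coe_filter, not_not, Set.mem_ofPred_eq] at hA
      exact insert_erase hA.2
    · intro A hA
      obtain ⟨hA, -, -⟩ := mem_separatedSets.1 hA
      exact erase_insert fun h => by have := mem_range.1 (hA h); omega

theorem card_separatedSets : ∀ n k : ℕ, #(separatedSets n k) = (n + 1 - k).choose k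
  | n, 0 => by
    have : separatedSets n 0 = {∅} := by
      ext A
      simp only [mem_separatedSets, card_eq_zero, mem_singleton]
      constructor
      · exact fun h => h.2.1
      · rintro rfl
        simp
    simp [this]
  | 0, k + 1 => by
    have : separatedSets 0 (k + 1) = ∅ := by simp [separatedSets]
    simp [this]
  | 1, k + 1 => by
    rcases k with _ | k
    · decide
    · have : separatedSets 1 (k + 1 + 1) = ∅ := by
        rw [separatedSets, powersetCard_eq_empty.2 (by simp), filter_empty]
      simp [this]
  | n + 2, k + 1 => by
    rw [card_separatedSets_add_two, card_separatedSets (n + 1) (k + 1), card_separatedSets n k]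
    rcases le_or_gt k (n + 1) with h | h
    · rw [show n + 2 + 1 - (k + 1) = (n + 1 - k) + 1 by omega,
        show n + 1 + 1 - (k + 1) = n + 1 - k by omega, Nat.choose_succ_succ]
      ring
    · rw [show n + 2 + 1 - (k + 1) = 0 by omega, show n + 1 + 1 - (k + 1) = 0 by omega,
        show n + 1 - k = 0 by omega, Nat.choose_eq_zero_of_lt (by omega),
        Nat.choose_eq_zero_of_lt (by omega)]

theorem card_innerSeparated {m d : ℕ} (hm : 2 ≤ m) :
    #(innerSeparated m d) = (m - d - 2).choose (d + 1) := by
  have h : #(separatedSets (m - 2) (d + 1)) = #(innerSeparated m d) := by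
    refine card_nbij' (fun A => A.image (· + 2)) (fun A => A.image (· - 2)) ?_ ?_ ?_ ?_
    · intro A hA
      obtain ⟨hA, hc, hs⟩ := mem_separatedSets.1 hA
      refine mem_innerSeparated.2 ⟨?_, ?_, ?_, ?_, ?_⟩
      · intro a ha
        obtain ⟨b, hb, rfl⟩ := mem_image.1 ha
        have := mem_range.1 (hA hb)
        exact mem_Icc.2 (by omega)
      · rw [card_image_of_injective _ (add_left_injective 2), hc]
      · intro a ha b hb hab
        obtain ⟨i, hi, rfl⟩ := mem_image.1 ha
        obtain ⟨j, hj, rfl⟩ := mem_image.1 hb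
        have := hs i hi j hj (by omega)
        omega
      · simp
      · intro h
        obtain ⟨b, hb, h⟩ := mem_image.1 h
        have := mem_range.1 (hA hb)
        omega
    · intro A hA
      obtain ⟨hA, hc, hs, h1, hm'⟩ := mem_innerSeparated.1 hA
      have h2 : ∀ a ∈ A, 2 ≤ a ∧ a < m := by
        intro a ha
        have h3 := mem_Icc.1 (hA ha)
        have h4 : a ≠ 1 := fun h => h1 (h ▸ ha)
        have h5 : a ≠ m := fun h => hm' (h ▸ ha)
        omega
      refine mem_separatedSets.2 ⟨?_, ?_, ?_⟩
      · intro a ha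
        obtain ⟨b, hb, rfl⟩ := mem_image.1 ha
        have := h2 b hb
        exact mem_range.2 (by omega)
      · rw [card_image_of_injOn, hc]
        intro a ha b hb hab
        have := h2 a ha
        have := h2 b hb
        dsimp only at hab
        omega
      · intro a ha b hb hab
        obtain ⟨i, hi, rfl⟩ := mem_image.1 ha
        obtain ⟨j, hj, rfl⟩ := mem_image.1 hb
        have := hs i hi j hj (by omega)
        have := h2 i hi
        omega
    · intro A hA
      simp [image_image, Function.comp_def]
    · intro A hA
      obtain ⟨hA, -, -, h1, -⟩ := mem_innerSeparated.1 hA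
      dsimp only
      rw [image_image]
      conv_rhs => rw [← image_id (s := A)]
      refine image_congr fun a ha => ?_
      have h3 := mem_Icc.1 (hA ha)
      have h4 : a ≠ 1 := fun h => h1 (h ▸ ha)
      simp only [Function.comp_apply, id_eq]
      omega
  rw [← h, card_separatedSets]
  congr 1
  omega

/-! ### Facets and internal simplices -/

/-- The linear functional on `ℝ ^ δ` whose restriction to the moment curve is `Q` without its
constant term. -/
noncomputable def momentFunctional (δ : ℕ) (Q : ℝ[X]) : (Fin δ → ℝ) →L[ℝ] ℝ :=
  ∑ j : Fin δ, Q.coeff (j + 1) • ContinuousLinearMap.proj (R := ℝ) (φ := fun _ : Fin δ => ℝ) j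

theorem momentFunctional_apply (δ : ℕ) (Q : ℝ[X]) (x : Fin δ → ℝ) :
    momentFunctional δ Q x = ∑ j : Fin δ, Q.coeff (j + 1) * x j := by
  simp [momentFunctional]

theorem momentEval_eq (δ : ℕ) (Q : ℝ[X]) (x : Fin δ → ℝ) :
    momentEval δ Q x = Q.coeff 0 + momentFunctional δ Q x := by
  rw [momentFunctional_apply, momentEval]

theorem momentPoint_mem_cyclicPolytope {m δ i : ℕ} (hi : i ∈ Icc 1 m) :
    momentPoint δ i ∈ cyclicPolytope m δ :=
  subset_convexHull ℝ _ ⟨i, hi, rfl⟩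

/-- Pairing a dependency with the nodal polynomial of the points other than `e` leaves only the term
of `e`. -/
theorem affineIndependent_momentPoint {δ : ℕ} {S : Finset ℕ} (hS : #S ≤ δ + 1) :
    AffineIndependent ℝ fun i : S => momentPoint δ i := by
  rw [affineIndependent_iff]
  intro s w hw hwp e he
  let Q : ℝ[X] := Lagrange.nodal (S.erase e) fun j : ℕ => (j : ℝ)
  have hdeg : Q.natDegree ≤ δ := by
    rw [Lagrange.natDegree_nodal, card_erase_of_mem e.2]
    omega
  have h1 : ∑ i ∈ s, w i * Q.eval ((i : ℕ) : ℝ) = 0 := by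
    have h2 : ∑ i ∈ s, w i * momentFunctional δ Q (momentPoint δ i) =
        momentFunctional δ Q (∑ i ∈ s, w i • momentPoint δ i) := by simp [map_sum]
    rw [hwp, map_zero] at h2
    simp only [← momentEval_momentPoint hdeg, momentEval_eq, mul_add, sum_add_distrib, ← sum_mul]
    rw [h2, hw]
    simp
  rw [sum_eq_single_of_mem e he] at h1
  · refine (mul_eq_zero.1 h1).resolve_right (Lagrange.eval_nodal_not_at_node fun j hj h => ?_)
    rw [Nat.cast_inj] at h
    exact (mem_erase.1 hj).1 h.symm
  · intro b _ hbe
    rw [Lagrange.eval_nodal_at_node (v := fun j : ℕ => (j : ℝ)) (i := (b : ℕ)), mul_zero]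
    exact mem_erase.2 ⟨fun h => hbe (Subtype.ext h), b.2⟩

theorem le_finrank_vectorSpan {δ n : ℕ} {S : Finset ℕ} (hS : #S = n + 1) (hn : n ≤ δ)
    {F : Set (Fin δ → ℝ)} (hF : ∀ i ∈ S, momentPoint δ i ∈ F) :
    n ≤ Module.finrank ℝ (vectorSpan ℝ F) := by
  rw [← (affineIndependent_momentPoint (δ := δ) (S := S) (by omega)).finrank_vectorSpan
    (n := n) (by simpa using hS)]
  refine Submodule.finrank_mono (vectorSpan_mono ℝ ?_)
  rintro _ ⟨i, rfl⟩
  exact hF i i.2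

theorem exists_polynomial_of_functional {δ : ℕ} (l : (Fin δ → ℝ) →L[ℝ] ℝ) :
    ∃ P : ℝ[X], P.natDegree ≤ δ ∧ ∀ i : ℕ, P.eval (i : ℝ) = l (momentPoint δ i) := by
  refine ⟨∑ j : Fin δ, C (l (Pi.single j 1)) * X ^ ((j : ℕ) + 1), ?_, ?_⟩
  · refine natDegree_sum_le_of_forall_le _ _ fun j _ => ?_
    exact (natDegree_C_mul_X_pow_le _ _).trans j.2
  · intro i
    have h : momentPoint δ i = ∑ j : Fin δ, (momentPoint δ i j) • (Pi.single j 1 : Fin δ → ℝ) := by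
      ext j
      simp [Finset.sum_apply, Pi.single_apply]
    rw [h, map_sum, eval_finsetSum]
    refine sum_congr rfl fun j _ => ?_
    rw [map_smul, smul_eq_mul, momentPoint, eval_mul, eval_C, eval_pow, eval_X, mul_comm]

/-- If `A` contains one of the two classes of an alternating sequence of `δ + 2` vertices, then
`|A|` is internal. -/
theorem isInternal_of_isDecreasing {m δ : ℕ} (hm : δ + 1 ≤ m) {A : Finset ℕ} {z : ℕ → ℕ} (c : ℕ)
    (hc : c < 2) (hz : IsDecreasing (δ + 2) z) (hzm : ∀ i < δ + 2, z i ∈ Icc 1 m)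
    (hA : ∀ i < δ + 2, i % 2 = c → z i ∈ A) : IsInternal m δ A := by
  rintro F ⟨hne, hexp, hrank⟩ hAF
  obtain ⟨l, rfl⟩ := hexp hne
  obtain ⟨P, hPdeg, hP⟩ := exists_polynomial_of_functional l
  obtain ⟨x₀, hx₀C, hx₀⟩ := hne
  -- `Q` is the slack of the functional exposing `F`: nonnegative on `[m]` and zero on `A`.
  let Q : ℝ[X] := C (l x₀) - P
  have hQ : ∀ i : ℕ, Q.eval (i : ℝ) = l x₀ - l (momentPoint δ i) := fun i => by simp [Q, hP]
  have hQdeg : Q.natDegree ≤ δ := (natDegree_sub_le _ _).trans (by simpa using hPdeg)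
  have hnonneg : ∀ i ∈ Icc 1 m, 0 ≤ Q.eval (i : ℝ) := fun i hi => by
    rw [hQ]
    linarith [hx₀ _ (momentPoint_mem_cyclicPolytope hi)]
  have hzero : ∀ i ∈ A, Q.eval (i : ℝ) ≤ 0 := fun i hi => by
    rw [hQ]
    linarith [(hAF (subset_convexHull ℝ _ ⟨i, hi, rfl⟩)).2 x₀ hx₀C]
  set Z := (range (δ + 2)).image z with hZ
  have hcard : #Z = δ + 2 := hz.card_image
  have hdd := dividedDifference_eval_eq_zero (Z := Z) (Q := Q) (by omega)
  -- The terms of class `c` vanish and the others share one sign, so a zero divided difference makes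
  -- every term zero.
  have hterm : ∀ k ∈ Z, 0 ≤ (-1) ^ (c + 1) * (divWeight Z k * Q.eval (k : ℝ)) := by
    intro k hk
    obtain ⟨i, hi, rfl⟩ := mem_image.1 hk
    rw [mem_range] at hi
    have h1 := hnonneg _ (hzm i hi)
    by_cases hic : i % 2 = c
    · rw [le_antisymm (hzero _ (hA i hi hic)) h1]
      simp
    · have h2 : (-1 : ℝ) ^ (c + 1) = (-1) ^ i := by
        rw [neg_one_pow_eq_pow_mod_two, neg_one_pow_eq_pow_mod_two (n := i)]
        congr 1
        omega
      rw [h2, ← mul_assoc]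
      exact mul_nonneg (hz.divWeight_sign hi).le h1
  have hsum : ∑ k ∈ Z, (-1) ^ (c + 1) * (divWeight Z k * Q.eval (k : ℝ)) = 0 := by
    rw [← mul_sum]
    rw [dividedDifference] at hdd
    rw [hdd, mul_zero]
  have hroot : ∀ k ∈ Z, Q.eval (k : ℝ) = 0 := by
    intro k hk
    have h1 := (sum_eq_zero_iff_of_nonneg hterm).1 hsum k hk
    have h2 : (-1 : ℝ) ^ (c + 1) ≠ 0 := by simp
    simpa [h2, divWeight_ne_zero hk] using h1
  -- With `δ + 2` roots `Q` vanishes, so `l` is constant on the moment curve and `F` contains `δ +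
  -- 1` affinely independent points, too many for a facet.
  have hQ0 : Q = 0 := by
    refine eq_zero_of_degree_lt_of_eval_index_eq_zero (v := fun j : ℕ => (j : ℝ)) (s := Z)
      (by simp [Nat.cast_injective.injOn]) ?_ hroot
    exact degree_le_natDegree.trans_lt (by exact_mod_cast (by omega))
  have := le_finrank_vectorSpan (δ := δ) (n := δ) (S := Icc 1 (δ + 1)) (by simp) le_rfl
    (F := {x ∈ cyclicPolytope m δ | ∀ y ∈ cyclicPolytope m δ, l y ≤ l x}) (by
      intro i hi
      have hi' : i ∈ Icc 1 m := by
        rw [mem_Icc] at hi ⊢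
        omega
      refine ⟨momentPoint_mem_cyclicPolytope hi', fun y hy => ?_⟩
      have h1 := hQ i
      rw [hQ0, eval_zero] at h1
      linarith [hx₀ y hy])
  omega

theorem momentEval_nonneg {m δ : ℕ} {Q : ℝ[X]} (hdeg : Q.natDegree ≤ δ)
    (hQ : ∀ i ∈ Icc 1 m, 0 ≤ Q.eval (i : ℝ)) {x : Fin δ → ℝ} (hx : x ∈ cyclicPolytope m δ) :
    0 ≤ momentEval δ Q x := by
  obtain ⟨w, hw⟩ := mem_geomSimplex_iff.1 hx
  rw [← hw.sum_eval hdeg]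
  exact sum_nonneg fun i hi => mul_nonneg (hw.nonneg i) (hQ i hi)

/-- A polynomial of degree `δ` which is nonnegative on `[m]` and vanishes at the `δ` points of `S`
defines a facet. -/
theorem isFacet_of_polynomial {m δ : ℕ} {S : Finset ℕ} (hSm : S ⊆ Icc 1 m) (hS : #S = δ + 1)
    {Q : ℝ[X]} (hdeg : Q.natDegree ≤ δ + 1) (hlead : Q.coeff (δ + 1) ≠ 0)
    (hQ : ∀ i ∈ Icc 1 m, 0 ≤ Q.eval (i : ℝ)) (hQS : ∀ i ∈ S, Q.eval (i : ℝ) = 0) :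
    IsFacet m (δ + 1) {x ∈ cyclicPolytope m (δ + 1) | momentEval (δ + 1) Q x = 0} := by
  have hmem : ∀ i ∈ S, momentPoint (δ + 1) i ∈
      {x ∈ cyclicPolytope m (δ + 1) | momentEval (δ + 1) Q x = 0} := fun i hi =>
    ⟨momentPoint_mem_cyclicPolytope (hSm hi), by rw [momentEval_momentPoint hdeg, hQS i hi]⟩
  obtain ⟨s₀, hs₀⟩ : S.Nonempty := card_pos.1 (by omega)
  refine ⟨⟨_, hmem s₀ hs₀⟩, fun _ => ⟨-momentFunctional (δ + 1) Q, ?_⟩, ?_⟩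
  · ext x
    refine and_congr_right fun hx => ⟨fun h0 y hy => ?_, fun hmax => ?_⟩
    · have h1 := momentEval_nonneg hdeg hQ hy
      rw [momentEval_eq] at h0 h1
      simp only [neg_apply]
      linarith
    · have h1 := momentEval_nonneg hdeg hQ hx
      have h2 := hmax _ (hmem s₀ hs₀).1
      have h3 := (hmem s₀ hs₀).2
      simp only [neg_apply] at h2
      rw [momentEval_eq] at h1 h3 ⊢
      linarith
  · have hge := le_finrank_vectorSpan (δ := δ + 1) hS (by omega) hmem
    have hker : vectorSpan ℝ {x ∈ cyclicPolytope m (δ + 1) | momentEval (δ + 1) Q x = 0} ≤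
        LinearMap.ker (momentFunctional (δ + 1) Q : (Fin (δ + 1) → ℝ) →ₗ[ℝ] ℝ) := by
      rw [vectorSpan_def, Submodule.span_le]
      rintro _ ⟨x, ⟨-, hx⟩, y, ⟨-, hy⟩, rfl⟩
      rw [momentEval_eq] at hx hy
      simp only [vsub_eq_sub, SetLike.mem_coe, LinearMap.mem_ker, ContinuousLinearMap.coe_coe,
        map_sub]
      linarith
    have hne : (momentFunctional (δ + 1) Q : (Fin (δ + 1) → ℝ) →ₗ[ℝ] ℝ) ≠ 0 := by
      intro h
      have h1 := congrArg (fun f => f (Pi.single (Fin.last δ) 1)) h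
      simp [momentFunctional_apply, Pi.single_apply] at h1
      exact hlead h1
    have h1 := Module.Dual.finrank_ker_add_one_of_ne_zero hne
    have h2 := Submodule.finrank_mono hker
    rw [Module.finrank_fin_fun] at h1
    omega

theorem geomSimplex_subset_of_polynomial {m δ : ℕ} {A : Finset ℕ} (hA : A ⊆ Icc 1 m) {Q : ℝ[X]}
    (hdeg : Q.natDegree ≤ δ) (hQA : ∀ i ∈ A, Q.eval (i : ℝ) = 0) :
    geomSimplex δ A ⊆ {x ∈ cyclicPolytope m δ | momentEval δ Q x = 0} := by
  intro x hx
  obtain ⟨w, hw⟩ := mem_geomSimplex_iff.1 hx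
  refine ⟨mem_geomSimplex_iff.2 ⟨w, hw.mono hA⟩, ?_⟩
  rw [← hw.sum_eval hdeg]
  exact sum_eq_zero fun i hi => by rw [hQA i hi, mul_zero]

theorem eval_nodal_natCast (S : Finset ℕ) (i : ℕ) :
    (Lagrange.nodal S fun j : ℕ => (j : ℝ)).eval (i : ℝ) = ∏ s ∈ S, ((i : ℝ) - s) :=
  Lagrange.eval_nodal

/-- The nodal polynomial of `S` cuts out the facet. Being monic, it has coefficient `1` at the last
coordinate, so its zeros are the lowest points over their projections. -/
theorem exists_lower_facet {m δ : ℕ} {A S : Finset ℕ} (hAS : A ⊆ S) (hSm : S ⊆ Icc 1 m)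
    (hS : #S = δ + 1) (h : ∀ j ∈ Icc 1 m, 0 ≤ ∏ s ∈ S, ((j : ℝ) - s)) :
    ∃ F, IsLowerFacet m δ F ∧ geomSimplex (δ + 1) A ⊆ F := by
  set Q : ℝ[X] := Lagrange.nodal S fun j : ℕ => (j : ℝ) with hQ
  have hdeg : Q.natDegree = δ + 1 := by rw [hQ, Lagrange.natDegree_nodal, hS]
  have hcoeff : Q.coeff (δ + 1) = 1 := by
    rw [← hdeg]
    exact Lagrange.nodal_monic
  have hpos : ∀ i ∈ Icc 1 m, 0 ≤ Q.eval (i : ℝ) := fun i hi => by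
    rw [hQ, eval_nodal_natCast]
    exact h i hi
  have hzero : ∀ i ∈ S, Q.eval (i : ℝ) = 0 := fun i hi =>
    Lagrange.eval_nodal_at_node (v := fun j : ℕ => (j : ℝ)) hi
  refine ⟨_, ⟨isFacet_of_polynomial hSm hS hdeg.le (by simp [hcoeff]) hpos hzero, ?_⟩,
    geomSimplex_subset_of_polynomial (hAS.trans hSm) hdeg.le fun i hi => hzero i (hAS hi)⟩
  rintro x ⟨-, hx⟩ y hy hxy
  have h1 := momentEval_nonneg hdeg.le hpos hy
  have h2 : ∀ v : Fin (δ + 1) → ℝ, momentEval (δ + 1) Q v =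
      Q.coeff 0 + ∑ j : Fin δ, Q.coeff (j + 1) * Fin.init v j + v (Fin.last δ) := by
    intro v
    rw [momentEval, Fin.sum_univ_castSucc]
    simp [hcoeff, Fin.init, add_assoc]
  rw [h2] at hx h1
  rw [hxy] at h1
  linarith

theorem exists_upper_facet {m δ : ℕ} {A S : Finset ℕ} (hAS : A ⊆ S) (hSm : S ⊆ Icc 1 m)
    (hS : #S = δ + 1) (h : ∀ j ∈ Icc 1 m, ∏ s ∈ S, ((j : ℝ) - s) ≤ 0) :
    ∃ F, IsFacet m (δ + 1) F ∧ geomSimplex (δ + 1) A ⊆ F := by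
  set Q : ℝ[X] := Lagrange.nodal S fun j : ℕ => (j : ℝ) with hQ
  have hdeg : Q.natDegree = δ + 1 := by rw [hQ, Lagrange.natDegree_nodal, hS]
  have hcoeff : Q.coeff (δ + 1) = 1 := by
    rw [← hdeg]
    exact Lagrange.nodal_monic
  have hzero : ∀ i ∈ S, (-Q).eval (i : ℝ) = 0 := fun i hi => by
    rw [eval_neg, Lagrange.eval_nodal_at_node (v := fun j : ℕ => (j : ℝ)) hi, neg_zero]
  refine ⟨_, isFacet_of_polynomial hSm hS (Q := -Q) (by rw [natDegree_neg, hdeg])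
    (by simp [hcoeff]) (fun i hi => ?_) hzero,
    geomSimplex_subset_of_polynomial (hAS.trans hSm) (by rw [natDegree_neg, hdeg])
      fun i hi => hzero i (hAS hi)⟩
  rw [eval_neg, hQ, eval_nodal_natCast]
  exact neg_nonneg.2 (h i hi)

theorem exists_consecutive_of_notMem {m d : ℕ} {A : Finset ℕ} (hA : A ⊆ Icc 1 m)
    (hcard : #A = d + 1) (hm : m ∉ A) (h : A ∉ innerSeparated m d) :
    1 ∈ A ∨ ∃ a ∈ A, a + 1 ∈ A := by
  by_contra hcon
  push Not at hcon
  refine h (mem_innerSeparated.2 ⟨hA, hcard, fun a ha b hb hab => ?_, hcon.1, hm⟩)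
  have h1 : b ≠ a + 1 := fun h => hcon.2 a ha (h ▸ hb)
  omega

theorem mem_internalSimplices {m δ k : ℕ} {A : Finset ℕ} : A ∈ internalSimplices m δ k ↔
    A ⊆ Icc 1 m ∧ #A = k + 1 ∧ IsInternal m δ A := by
  simp [internalSimplices, and_assoc]

/-- A set which is not inner separated contains `m`, or `1`, or two consecutive elements, and then
completes to the vertices of a facet. An inner separated set is one class of a circuit, hence
internal. -/
theorem internalSimplices_eq_innerSeparated {m d : ℕ} (hm : 2 * d + 2 ≤ m) :
    internalSimplices m (2 * d + 1) d = innerSeparated m d := by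
  ext A
  rw [mem_internalSimplices]
  constructor
  · rintro ⟨hA, hcard, hint⟩
    by_contra hcon
    by_cases hmA : m ∈ A
    · obtain ⟨S, hAS, hSm, hS, hprod⟩ := exists_upper_completion (by omega) hA hcard hmA
      obtain ⟨F, hF, hAF⟩ := exists_upper_facet hAS hSm hS hprod
      exact hint F hF hAF
    · obtain ⟨S, hAS, hSm, hS, hprod⟩ := exists_lower_completion (by omega) hA hcard
        (exists_consecutive_of_notMem hA hcard hmA hcon)
      obtain ⟨F, hF, hAF⟩ := exists_lower_facet hAS hSm hS hprod
      exact hint F hF.1 hAF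
  · intro hA
    have h := mem_innerSeparated.1 hA
    obtain ⟨z, hz, hzm, hodd, -⟩ := exists_isDecreasing_odd hA
    exact ⟨h.1, h.2.1, isInternal_of_isDecreasing hm 1 (by omega) hz hzm
      fun i hi hi1 => hodd i hi (Nat.odd_iff.2 hi1)⟩

theorem mem_internalNonLowerSimplices {m δ k : ℕ} {A : Finset ℕ} :
    A ∈ internalNonLowerSimplices m δ k ↔ A ⊆ Icc 1 m ∧ #A = k + 1 ∧ IsInternal m δ A ∧
      ∀ F, IsLowerFacet m δ F → ¬ geomSimplex (δ + 1) A ⊆ F := by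
  simp [internalNonLowerSimplices, mem_internalSimplices, and_assoc]

theorem subset_Icc_of_mem_innerSeparated {m d : ℕ} {A : Finset ℕ}
    (hA : A ∈ innerSeparated (m + 1) d) : A ⊆ Icc 1 m := by
  obtain ⟨hA, -, -, -, hm⟩ := mem_innerSeparated.1 hA
  intro a ha
  have h1 := mem_Icc.1 (hA ha)
  have h2 : a ≠ m + 1 := fun h => hm (h ▸ ha)
  exact mem_Icc.2 (by omega)

theorem internalNonLowerSimplices_eq_innerSeparated {m d : ℕ} (hm : 2 * d + 1 ≤ m) :
    internalNonLowerSimplices m (2 * d) d = innerSeparated (m + 1) d := by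
  ext A
  rw [mem_internalNonLowerSimplices]
  constructor
  · rintro ⟨hA, hcard, -, hlow⟩
    by_contra hcon
    obtain ⟨S, hAS, hSm, hS, hprod⟩ := exists_lower_completion hm hA hcard
      (exists_consecutive_of_notMem (hA.trans (Icc_subset_Icc_right (by omega))) hcard
        (fun h => by have := mem_Icc.1 (hA h); omega) hcon)
    obtain ⟨F, hF, hAF⟩ := exists_lower_facet hAS hSm hS hprod
    exact hlow F hF hAF
  · intro hA
    have h := mem_innerSeparated.1 hA
    obtain ⟨z, hz, hzm, heven, -⟩ := exists_isDecreasing_even hA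
    refine ⟨subset_Icc_of_mem_innerSeparated hA, h.2.1, isInternal_of_isDecreasing hm 0 (by omega)
      hz hzm fun i hi hi0 => heven i hi (Nat.even_iff.2 hi0), fun F hF hAF => ?_⟩
    -- `A` alternates with `[m]`, so a point of the lifted `|A|` is strictly above another point of
    -- the polytope.
    obtain ⟨x, w, w', hw, hw', hlt⟩ := Alternates.exists_weights (δ := 2 * d) (S := A)
      (S' := Icc 1 m) ⟨z, hz, heven, fun i hi _ => hzm i hi⟩
    obtain ⟨y, hy, hyx⟩ := hw.lift
    obtain ⟨y', hy', hyx'⟩ := hw'.lift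
    have := hF.2 y (hAF (mem_geomSimplex_iff.2 ⟨w, hy⟩)) y' (mem_geomSimplex_iff.2 ⟨w', hy'⟩)
      (hyx'.trans hyx.symm)
    rw [hy.last, hy'.last] at this
    linarith

/-! ### The two order embeddings -/

theorem Alternates.image_even {n : ℕ} {S' : Finset ℕ} {z : ℕ → ℕ} (hz : IsDecreasing n z)
    (hS' : ∀ i < n, Odd i → z i ∈ S') {k : ℕ} (hk : n ≤ 2 * k) :
    Alternates n ((range k).image fun i => z (2 * i)) S' := by
  refine ⟨z, hz, fun i hi he => ?_, hS'⟩
  obtain ⟨j, rfl⟩ := even_iff_two_dvd.1 he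
  exact mem_image.2 ⟨j, mem_range.2 (by omega), rfl⟩

theorem Alternates.two_mul_card {n : ℕ} {S S' : Finset ℕ} (h : Alternates n S S') :
    n ≤ 2 * #S := by
  obtain ⟨z, hz, hS, -⟩ := h
  have hc : ∀ i < (n + 1) / 2, 2 * i + 0 < n := by omega
  have h1 := (hz.subseq hc).card_image
  have h2 : #((range ((n + 1) / 2)).image fun i => z (2 * i + 0)) ≤ #S := by
    refine card_le_card fun k hk => ?_
    obtain ⟨i, hi, rfl⟩ := mem_image.1 hk
    exact hS _ (hc i (mem_range.1 hi)) (by simp)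
  omega

theorem Triangulation.mem_internalFaces {m δ k : ℕ} {T : Triangulation m δ} {A : Finset ℕ} :
    A ∈ T.internalFaces k ↔ A ∈ internalSimplices m δ k ∧ ∃ S ∈ T.simplices, A ⊆ S := by
  simp [Triangulation.internalFaces]

theorem Triangulation.mem_submersionSet {m δ k : ℕ} {T : Triangulation m δ} {A : Finset ℕ} :
    A ∈ T.submersionSet k ↔ (A ⊆ Icc 1 m ∧ #A = k + 1) ∧ T.Submerges A := by
  simp [Triangulation.submersionSet]

theorem mem_Icc_of_alternating {m δ n : ℕ} {T T' : Triangulation m δ} {S S' : Finset ℕ}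
    (hS : S ∈ T.simplices) (hS' : S' ∈ T'.simplices) {z : ℕ → ℕ}
    (h1 : ∀ i < n, Even i → z i ∈ S) (h2 : ∀ i < n, Odd i → z i ∈ S') :
    ∀ i < n, z i ∈ Icc 1 m := by
  intro i hi
  rcases Nat.even_or_odd i with he | ho
  · exact T.vertices_subset S hS (h1 i hi he)
  · exact T'.vertices_subset S' hS' (h2 i hi ho)

/-- Given `T ≤ T'`, locate the barycentre of a face `B` of `T'` in a simplex `S` of `T`. If `B` is
not in `S` they alternate; `B` is too small to contribute the greatest term, and `S` doing so
contradicts `T ≤ T'`. Conversely, the odd terms of an alternation of `S` with `S'` form a face of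
`T'`, which cannot be a face of `T` since `S` alternates with it. -/
theorem le_iff_internalFaces_subset {m d : ℕ} (hm : 2 * d + 2 ≤ m)
    (T T' : Triangulation m (2 * d + 1)) :
    T ≤ T' ↔ T'.internalFaces d ⊆ T.internalFaces d := by
  constructor
  · intro h B hB
    obtain ⟨hBI, S', hS', hBS'⟩ := Triangulation.mem_internalFaces.1 hB
    refine Triangulation.mem_internalFaces.2 ⟨hBI, ?_⟩
    have hcard := (mem_internalSimplices.1 hBI).2.1
    obtain ⟨w, x, hw, hpos⟩ := exists_isWeight_pos (2 * d + 1) (A := B) (card_pos.1 (by omega))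
    obtain ⟨S, hS, w', hw'⟩ := T.exists_weight (T'.mem_cyclicPolytope hS' (hw.mono hBS'))
    refine ⟨S, hS, ?_⟩
    by_cases hne : w = w'
    · subst hne
      intro i hi
      by_contra hcon
      exact (hpos i hi).ne' (hw'.zero_off i hcon)
    · exfalso
      rcases le_total (∑ i ∈ S, w' i * (i : ℝ) ^ (2 * d + 1 + 1))
        (∑ i ∈ B, w i * (i : ℝ) ^ (2 * d + 1 + 1)) with hle | hle
      · have := (hw.alternates hw' hne hle).two_mul_card
        omega
      · exact (T.le_iff T').1 h S hS S' hS'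
          ((hw'.alternates hw (Ne.symm hne) hle).mono Subset.rfl hBS')
  · intro h
    rw [T.le_iff]
    rintro S hS S' hS' ⟨z, hz, h1, h2⟩
    have hzm := mem_Icc_of_alternating hS hS' h1 h2
    have hB : (range (d + 1)).image (fun i => z (2 * i + 1)) ∈ T'.internalFaces d := by
      refine Triangulation.mem_internalFaces.2 ⟨?_, S', hS', ?_⟩
      · rw [internalSimplices_eq_innerSeparated hm]
        exact hz.image_odd_mem_innerSeparated hzm
      · intro k hk
        obtain ⟨i, hi, rfl⟩ := mem_image.1 hk
        exact h2 _ (by have := mem_range.1 hi; omega) ⟨i, rfl⟩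
    obtain ⟨-, S'', hS'', hBS''⟩ := Triangulation.mem_internalFaces.1 (h hB)
    refine T.not_alternates hS hS'' ⟨z, hz, h1, fun i hi ho => hBS'' ?_⟩
    obtain ⟨j, rfl⟩ := ho
    exact mem_image.2 ⟨j, mem_range.2 (by omega), rfl⟩

/-- Submersion passes to higher sections. Conversely, the even terms of an alternation of `S` with
`S'` lie in `S`, hence are submerged by `T`, but they alternate with `S'`, so `T'` does not submerge
them. -/
theorem le_iff_submersionSet_subset {m d : ℕ} (hm : 2 * d + 1 ≤ m)
    (T T' : Triangulation m (2 * d)) :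
    T ≤ T' ↔ T.submersionSet d ∩ internalNonLowerSimplices m (2 * d) d ⊆
      T'.submersionSet d ∩ internalNonLowerSimplices m (2 * d) d := by
  constructor
  · intro h A hA
    obtain ⟨hA, hAI⟩ := mem_inter.1 hA
    obtain ⟨hAc, hAT⟩ := Triangulation.mem_submersionSet.1 hA
    refine mem_inter.2 ⟨Triangulation.mem_submersionSet.2 ⟨hAc, fun x hx => (hAT x hx).trans ?_⟩,
      hAI⟩
    obtain ⟨w, hw⟩ := mem_geomSimplex_iff.1 hx
    exact h ⟨x, mem_geomSimplex_iff.2 ⟨w, hw.mono hAc.1⟩⟩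
  · intro h
    rw [T.le_iff]
    rintro S hS S' hS' ⟨z, hz, h1, h2⟩
    have hzm := mem_Icc_of_alternating hS hS' h1 h2
    set A := (range (d + 1)).image fun i => z (2 * i) with hA
    have hAI : A ∈ innerSeparated (m + 1) d := hz.image_even_mem_innerSeparated hzm
    have hAm := subset_Icc_of_mem_innerSeparated hAI
    have hcard : #A = d + 1 := (mem_innerSeparated.1 hAI).2.1
    have hAS : A ⊆ S := by
      intro k hk
      obtain ⟨i, hi, rfl⟩ := mem_image.1 hk
      exact h1 _ (by have := mem_range.1 hi; omega) (by simp)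
    have hsub : A ∈ T.submersionSet d := by
      refine Triangulation.mem_submersionSet.2 ⟨⟨hAm, hcard⟩, ?_⟩
      exact (T.submerges_iff (by omega) hAm).2 fun S'' hS'' halt =>
        T.not_alternates hS hS'' (halt.mono hAS Subset.rfl)
    have hsub' := (mem_inter.1 (h (mem_inter.2 ⟨hsub, by
      rwa [internalNonLowerSimplices_eq_innerSeparated hm]⟩))).1
    exact (T'.submerges_iff (by omega) hAm).1 (Triangulation.mem_submersionSet.1 hsub').2 S' hS'
      (Alternates.image_even hz h2 (by omega))

/-! ### Regular triangulations from generic heights -/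

open Filter Topology

/-- `B` lies on a lower face of the configuration of the points `p(i)`, `i ∈ [m]`, lifted to the
heights `f i`. -/
def IsSupported (m δ : ℕ) (f : ℕ → ℝ) (B : Finset ℕ) : Prop :=
  ∃ ℓ : ℝ[X], ℓ.natDegree ≤ δ ∧ (∀ i ∈ Icc 1 m, ℓ.eval (i : ℝ) ≤ f i) ∧
    ∀ i ∈ B, ℓ.eval (i : ℝ) = f i

theorem IsSupported.mono {m δ : ℕ} {f : ℕ → ℝ} {A B : Finset ℕ} (h : IsSupported m δ f B)
    (hAB : A ⊆ B) : IsSupported m δ f A := by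
  obtain ⟨ℓ, h1, h2, h3⟩ := h
  exact ⟨ℓ, h1, h2, fun i hi => h3 i (hAB hi)⟩

/-- The heights `f` are generic: no `δ + 2` of the lifted points lie on a hyperplane. -/
def IsGeneric (m δ : ℕ) (f : ℕ → ℝ) : Prop :=
  ∀ Z ⊆ Icc 1 m, #Z = δ + 2 → dividedDifference f Z ≠ 0

theorem IsGeneric.card_le {m δ : ℕ} {f : ℕ → ℝ} (hf : IsGeneric m δ f) {ℓ : ℝ[X]}
    (hℓ : ℓ.natDegree ≤ δ) {S : Finset ℕ} (hS : S ⊆ Icc 1 m)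
    (h : ∀ i ∈ S, ℓ.eval (i : ℝ) = f i) : #S ≤ δ + 1 := by
  by_contra hcon
  obtain ⟨Z, hZS, hZ⟩ := exists_subset_card_eq (show δ + 2 ≤ #S by omega)
  refine hf Z (hZS.trans hS) hZ ?_
  rw [← dividedDifference_congr fun i hi => h i (hZS hi)]
  exact dividedDifference_eval_eq_zero (by omega)

/-- Each of `ℓ` and `ℓ'` is below `f` where the other touches it, so they agree at `x`. Hence `ℓ`
touches `f` at every vertex of positive weight `w'`, and by genericity it touches only at the `δ +
1` points of `S`. -/
theorem IsSupported.mem_of_weight_ne_zero {m δ : ℕ} {f : ℕ → ℝ} (hf : IsGeneric m δ f)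
    {S B : Finset ℕ} (hS : IsSupported m δ f S) (hSm : S ⊆ Icc 1 m) (hcard : #S = δ + 1)
    (hB : IsSupported m δ f B) (hBm : B ⊆ Icc 1 m) {x : Fin δ → ℝ} {w w' : ℕ → ℝ}
    (hw : IsWeight δ S w x) (hw' : IsWeight δ B w' x) {i : ℕ} (hi : w' i ≠ 0) : i ∈ S := by
  obtain ⟨ℓ, hdeg, hle, heq⟩ := hS
  obtain ⟨ℓ', hdeg', hle', heq'⟩ := hB
  have h1 : ∑ j ∈ S, w j * ℓ'.eval (j : ℝ) ≤ ∑ j ∈ S, w j * ℓ.eval (j : ℝ) :=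
    sum_le_sum fun j hj => mul_le_mul_of_nonneg_left
      ((hle' j (hSm hj)).trans (heq j hj).ge) (hw.nonneg j)
  rw [hw.sum_eval hdeg, hw.sum_eval hdeg', ← hw'.sum_eval hdeg, ← hw'.sum_eval hdeg'] at h1
  have hterm : ∀ j ∈ B, 0 ≤ w' j * (ℓ'.eval (j : ℝ) - ℓ.eval (j : ℝ)) := fun j hj =>
    mul_nonneg (hw'.nonneg j) (by rw [heq' j hj]; linarith [hle j (hBm hj)])
  have h2 : ∑ j ∈ B, w' j * (ℓ'.eval (j : ℝ) - ℓ.eval (j : ℝ)) = 0 := by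
    refine le_antisymm ?_ (sum_nonneg hterm)
    simp only [mul_sub, sum_sub_distrib]
    linarith
  have hiB : i ∈ B := by
    by_contra h
    exact hi (hw'.zero_off i h)
  have h3 := (sum_eq_zero_iff_of_nonneg hterm).1 h2 i hiB
  have h4 : ℓ.eval (i : ℝ) = f i := by
    rw [← heq' i hiB]
    exact (sub_eq_zero.1 ((mul_eq_zero.1 h3).resolve_left hi)).symm
  by_contra hiS
  have := hf.card_le hdeg (S := insert i S) (insert_subset (hBm hiB) hSm) fun j hj => by
    rcases mem_insert.1 hj with rfl | hj
    · exact h4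
    · exact heq j hj
  rw [card_insert_of_notMem hiS] at this
  omega

/-- The vectors of values on `[m]` of the polynomials of degree at most `δ`. -/
noncomputable def polynomialValues (m δ : ℕ) : Submodule ℝ (Icc 1 m → ℝ) :=
  (degreeLT ℝ (δ + 1)).map (LinearMap.pi fun i : Icc 1 m => leval (R := ℝ) ((i : ℕ) : ℝ))

theorem mem_polynomialValues {m δ : ℕ} {v : Icc 1 m → ℝ} : v ∈ polynomialValues m δ ↔
    ∃ ℓ : ℝ[X], ℓ.natDegree ≤ δ ∧ ∀ i : Icc 1 m, ℓ.eval ((i : ℕ) : ℝ) = v i := by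
  simp only [polynomialValues, Submodule.mem_map, mem_degreeLT]
  refine exists_congr fun ℓ => and_congr ?_ ?_
  · rw [← Nat.lt_succ_iff]
    rcases eq_or_ne ℓ 0 with rfl | h
    · simp
    · rw [degree_eq_natDegree h]
      exact Nat.cast_lt
  · rw [funext_iff]
    rfl

theorem exists_pos_add_mul_le {ι : Type*} [Finite ι] {v f u : ι → ℝ} (hv : ∀ i, v i ≤ f i)
    (hu : ∀ i, v i = f i → u i ≤ 0) : ∃ ε > 0, ∀ i, v i + ε * u i ≤ f i := by
  have h : ∀ᶠ ε in 𝓝[>] (0 : ℝ), ∀ i, v i + ε * u i ≤ f i := by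
    rw [eventually_all]
    intro i
    rcases (hv i).eq_or_lt with h | h
    · filter_upwards [self_mem_nhdsWithin] with ε hε
      have := mul_nonpos_of_nonneg_of_nonpos (le_of_lt hε) (hu i h)
      linarith
    · have hc : Tendsto (fun ε : ℝ => v i + ε * u i) (𝓝 0) (𝓝 (v i + 0 * u i)) :=
        Continuous.tendsto (by fun_prop) 0
      rw [zero_mul, add_zero] at hc
      exact ((hc.eventually (gt_mem_nhds h)).filter_mono nhdsWithin_le_nhds).mono
        fun _ h => le_of_lt h
  obtain ⟨ε, hε, hpos⟩ := (h.and self_mem_nhdsWithin).exists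
  exact ⟨ε, hpos, hε⟩

/-- A linear functional with positive coefficients attains its maximum over the vectors of a
subspace which are bounded above by `f` at a vector `v` such that no nonzero vector of the subspace
vanishes where `v = f`. -/
theorem exists_vertex_isMax {ι : Type*} [Fintype ι] (V : Submodule ℝ (ι → ℝ)) {w f : ι → ℝ}
    (hw : ∀ i, 0 < w i) (hne : ∃ v ∈ V, ∀ i, v i ≤ f i) :
    ∃ v ∈ V, (∀ i, v i ≤ f i) ∧ (∀ u ∈ V, (∀ i, v i = f i → u i ≤ 0) → ∑ i, w i * u i ≤ 0) ∧
      ∀ u ∈ V, (∀ i, v i = f i → u i = 0) → u = 0 := by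
  classical
  obtain ⟨v₀, hv₀V, hv₀⟩ := hne
  let φ : (ι → ℝ) →L[ℝ] ℝ :=
    ∑ i, w i • ContinuousLinearMap.proj (R := ℝ) (φ := fun _ : ι => ℝ) i
  have hφ : ∀ v, φ v = ∑ i, w i * v i := fun v => by simp [φ]
  let K : Set (ι → ℝ) := {v | v ∈ V ∧ (∀ i, v i ≤ f i) ∧ φ v₀ ≤ φ v}
  have hKclosed : IsClosed K := by
    refine IsClosed.inter (Submodule.closed_of_finiteDimensional V) (IsClosed.inter ?_ ?_)
    · have : {v : ι → ℝ | ∀ i, v i ≤ f i} = ⋂ i, {v | v i ≤ f i} := by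
        ext
        simp
      change IsClosed {v : ι → ℝ | ∀ i, v i ≤ f i}
      rw [this]
      exact isClosed_iInter fun i => isClosed_le (continuous_apply i) continuous_const
    · exact isClosed_le continuous_const φ.continuous
  -- Upper bounds on all coordinates and a lower bound on a positive combination of them bound each
  -- coordinate below.
  have hKsub : K ⊆ Set.Icc (fun i => (φ v₀ - ∑ j ∈ univ.erase i, w j * f j) / w i) f := by
    rintro v ⟨-, hvf, hv⟩
    refine ⟨fun i => ?_, hvf⟩
    dsimp only
    rw [div_le_iff₀ (hw i)]
    have h1 : φ v = w i * v i + ∑ j ∈ univ.erase i, w j * v j := by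
      rw [hφ, add_sum_erase univ (fun j => w j * v j) (mem_univ i)]
    have h2 : ∑ j ∈ univ.erase i, w j * v j ≤ ∑ j ∈ univ.erase i, w j * f j :=
      sum_le_sum fun j _ => mul_le_mul_of_nonneg_left (hvf j) (hw j).le
    linarith
  have hKcompact : IsCompact K := isCompact_Icc.of_isClosed_subset hKclosed hKsub
  obtain ⟨v₁, hv₁K, hv₁⟩ := hKcompact.exists_isMaxOn ⟨v₀, hv₀V, hv₀, le_rfl⟩
    φ.continuous.continuousOn
  -- The vertex is an extreme point of the compact face of maximisers.
  have hexp : IsExposed ℝ K (φ.toExposed K) := ContinuousLinearMap.toExposed.isExposed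
  obtain ⟨v, hv⟩ := (hexp.isCompact hKcompact).extremePoints_nonempty
    ⟨v₁, hv₁K, fun y hy => hv₁ hy⟩
  have hvmax := hv.1
  have hvext := hexp.isExtreme.extremePoints_subset_extremePoints hv
  obtain ⟨⟨hvV, hvf, hvφ⟩, hmax⟩ := hvmax
  have hdir : ∀ u ∈ V, (∀ i, v i = f i → u i ≤ 0) → φ u ≤ 0 := by
    intro u hu htight
    by_contra hpos
    obtain ⟨ε, hε, hle⟩ := exists_pos_add_mul_le hvf htight
    have h1 : φ (v + ε • u) = φ v + ε * φ u := by simp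
    have h2 : 0 < ε * φ u := mul_pos hε (not_le.1 hpos)
    have h3 := hmax (v + ε • u) ⟨V.add_mem hvV (V.smul_mem ε hu), fun i => by simpa using hle i,
      by linarith⟩
    linarith
  refine ⟨v, hvV, hvf, fun u hu htight => hφ u ▸ hdir u hu htight, fun u hu htight => ?_⟩
  have h0 : φ u = 0 := by
    refine le_antisymm (hdir u hu fun i hi => (htight i hi).le) ?_
    have := hdir (-u) (V.neg_mem hu) fun i hi => by simp [htight i hi]
    rw [map_neg] at this
    linarith
  -- A direction vanishing on the tight coordinates can be followed both ways inside `K`;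
  -- extremality then makes it zero.
  obtain ⟨ε, hε, hle⟩ := exists_pos_add_mul_le hvf fun i hi => (htight i hi).le
  obtain ⟨ε', hε', hle'⟩ := exists_pos_add_mul_le (u := -u) hvf fun i hi => by simp [htight i hi]
  have hmem : v + ε • u ∈ K :=
    ⟨V.add_mem hvV (V.smul_mem ε hu), fun i => by simpa using hle i, by simp [h0, hvφ]⟩
  have hmem' : v + ε' • (-u) ∈ K :=
    ⟨V.add_mem hvV (V.smul_mem ε' (V.neg_mem hu)), fun i => by simpa using hle' i,
      by simp [h0, hvφ]⟩
  have hseg : v ∈ openSegment ℝ (v + ε • u) (v + ε' • (-u)) := by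
    refine ⟨ε' / (ε + ε'), ε / (ε + ε'), by positivity, by positivity, by field_simp; ring, ?_⟩
    ext i
    simp only [Pi.add_apply, Pi.smul_apply, Pi.neg_apply, smul_eq_mul]
    field_simp
    ring
  have h1 := hvext.2 hmem hmem' hseg
  have h2 : ε • u = 0 := by simpa using h1
  exact (smul_eq_zero.1 h2).resolve_left hε.ne'

theorem sum_eval_mul_eval_basis {δ : ℕ} {S : Finset ℕ} (hS : #S = δ + 1) {Q : ℝ[X]}
    (hQ : Q.natDegree ≤ δ) (x : ℝ) :
    ∑ s ∈ S, Q.eval (s : ℝ) * (Lagrange.basis S (fun j : ℕ => (j : ℝ)) s).eval x = Q.eval x := by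
  conv_rhs => rw [Lagrange.eq_interpolate_of_eval_eq (s := S) (v := fun j : ℕ => (j : ℝ))
    (fun s => Q.eval (s : ℝ)) (by simp [Nat.cast_injective.injOn])
    (degree_le_natDegree.trans_lt (by rw [hS]; exact_mod_cast Nat.lt_succ_of_le hQ))
    fun _ _ => rfl]
  simp [Lagrange.interpolate_apply, eval_finsetSum]

/-- This is linear programming duality: maximise `ℓ(x)` over polynomials `ℓ` of degree at most `δ`
below `f` on `[m]`. At an optimal vertex the tight set is the required simplex. Positivity of `w`
makes the problem bounded. -/
theorem exists_isSupported_of_pos {m δ : ℕ} (hm : δ + 1 ≤ m) {f : ℕ → ℝ} (hf : IsGeneric m δ f)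
    {w : ℕ → ℝ} {x : Fin δ → ℝ} (hw : IsWeight δ (Icc 1 m) w x) (hpos : ∀ i ∈ Icc 1 m, 0 < w i) :
    ∃ S ⊆ Icc 1 m, #S = δ + 1 ∧ IsSupported m δ f S ∧ x ∈ geomSimplex δ S := by
  obtain ⟨b, hb⟩ : ∃ b, ∀ i ∈ Icc 1 m, b ≤ f i := by
    obtain ⟨b, hb⟩ := ((Icc 1 m).image f).bddBelow
    exact ⟨b, fun i hi => hb (mem_coe.2 (mem_image_of_mem f hi))⟩
  obtain ⟨v, hvV, hvf, hdir, hext⟩ := exists_vertex_isMax (polynomialValues m δ)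
    (w := fun i : Icc 1 m => w i) (f := fun i : Icc 1 m => f i) (fun i => hpos i i.2)
    ⟨fun _ => b, mem_polynomialValues.2 ⟨C b, by simp, by simp⟩, fun i => hb i i.2⟩
  obtain ⟨ℓ, hℓdeg, hℓ⟩ := mem_polynomialValues.1 hvV
  set S := (Icc 1 m).filter fun i : ℕ => ℓ.eval (i : ℝ) = f i with hS
  have hSm : S ⊆ Icc 1 m := filter_subset _ _
  have htight : ∀ i : Icc 1 m, v i = f i → (i : ℕ) ∈ S := fun i hi =>
    mem_filter.2 ⟨i.2, by rw [hℓ, hi]⟩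
  have hle : #S ≤ δ + 1 := hf.card_le hℓdeg hSm fun i hi => (mem_filter.1 hi).2
  have hcard : #S = δ + 1 := by
    by_contra hcon
    -- With too few tight points, their nodal polynomial is a nonzero direction vanishing on all of
    -- them.
    let Q : ℝ[X] := Lagrange.nodal S fun j : ℕ => (j : ℝ)
    have h1 := hext (fun i => Q.eval ((i : ℕ) : ℝ)) (mem_polynomialValues.2
      ⟨Q, by rw [Lagrange.natDegree_nodal]; omega, fun _ => rfl⟩) fun i hi =>
        Lagrange.eval_nodal_at_node (v := fun j : ℕ => (j : ℝ)) (htight i hi)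
    obtain ⟨k, hk, hkS⟩ := exists_mem_notMem_of_card_lt_card
      (show #S < #(Icc 1 m) by rw [Nat.card_Icc]; omega)
    refine Lagrange.eval_nodal_not_at_node (v := fun j : ℕ => (j : ℝ)) (s := S) (x := (k : ℝ))
      (fun j hj h => hkS ?_) (congrFun h1 ⟨k, hk⟩)
    rw [Nat.cast_inj] at h
    exact h ▸ hj
  refine ⟨S, hSm, hcard, ⟨ℓ, hℓdeg, fun i hi => ?_, fun i hi => (mem_filter.1 hi).2⟩, ?_⟩
  · exact (hℓ ⟨i, hi⟩).trans_le (hvf ⟨i, hi⟩)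
  · let L : ℕ → ℝ[X] := Lagrange.basis S fun j : ℕ => (j : ℝ)
    have hinj : Set.InjOn (fun j : ℕ => (j : ℝ)) S := Nat.cast_injective.injOn
    have hLdeg : ∀ s ∈ S, (L s).natDegree ≤ δ := fun s hs => by
      rw [Lagrange.natDegree_basis hinj hs]
      omega
    have hsum : ∀ Q : ℝ[X], Q.natDegree ≤ δ →
        ∑ s ∈ S, momentEval δ (L s) x * Q.eval (s : ℝ) = momentEval δ Q x := by
      intro Q hQ
      rw [← hw.sum_eval hQ]
      rw [sum_congr rfl fun s hs => by rw [← hw.sum_eval (hLdeg s hs)]]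
      simp only [sum_mul]
      rw [sum_comm]
      refine sum_congr rfl fun i _ => ?_
      rw [← sum_eval_mul_eval_basis hcard hQ, mul_sum]
      exact sum_congr rfl fun s _ => by ring
    refine mem_geomSimplex_iff.2 ⟨fun s => if s ∈ S then momentEval δ (L s) x else 0,
      .of_sum_pow ?_ (fun i hi => if_neg hi) ?_ fun j => ?_⟩
    · intro s
      split_ifs with hs
      · have h1 := hdir (fun i => (-L s).eval ((i : ℕ) : ℝ)) (mem_polynomialValues.2
          ⟨-L s, by rw [natDegree_neg]; exact hLdeg s hs, fun _ => rfl⟩) fun i hi => by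
            rw [eval_neg, neg_nonpos]
            rcases eq_or_ne s i with rfl | hne
            · exact (Lagrange.eval_basis_self hinj hs).ge.trans' zero_le_one
            · exact (Lagrange.eval_basis_of_ne (v := fun j : ℕ => (j : ℝ)) hne (htight i hi)).ge
        rw [← hw.sum_eval (hLdeg s hs)]
        rw [sum_coe_sort (Icc 1 m) fun i => w i * (-L s).eval (i : ℝ)] at h1
        simp only [eval_neg, mul_neg, sum_neg_distrib] at h1
        linarith
      · exact le_rfl
    · rw [sum_congr rfl fun s hs => if_pos hs]
      have h1 := hsum 1 (by simp)
      have h2 : momentEval δ (1 : ℝ[X]) x = 1 := by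
        simp [momentEval, coeff_one]
      simpa [h2] using h1
    · have h1 := hsum (X ^ ((j : ℕ) + 1)) (by rw [natDegree_X_pow]; omega)
      have h2 : momentEval δ (X ^ ((j : ℕ) + 1) : ℝ[X]) x = x j := by
        simp [momentEval, coeff_X_pow, ← Fin.ext_iff]
      rw [h2] at h1
      rw [← h1]
      exact sum_congr rfl fun s hs => by simp [hs]

theorem isClosed_geomSimplex (δ : ℕ) (A : Finset ℕ) : IsClosed (geomSimplex δ A) :=
  ((A.finite_toSet.image _).isCompact_convexHull ℝ).isClosed

open Classical in
/-- The simplices of the regular triangulation with heights `f`. -/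
noncomputable def regularSimplices (m δ : ℕ) (f : ℕ → ℝ) : Finset (Finset ℕ) :=
  (powersetCard (δ + 1) (Icc 1 m)).filter (IsSupported m δ f)

theorem mem_regularSimplices {m δ : ℕ} {f : ℕ → ℝ} {S : Finset ℕ} : S ∈ regularSimplices m δ f ↔
    S ⊆ Icc 1 m ∧ #S = δ + 1 ∧ IsSupported m δ f S := by
  simp [regularSimplices, and_assoc]

/-- Points with all weights positive are covered and approximate every point; a finite union of
simplices is closed. -/
theorem cyclicPolytope_subset_regularSimplices {m δ : ℕ} (hm : δ + 1 ≤ m) {f : ℕ → ℝ}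
    (hf : IsGeneric m δ f) :
    cyclicPolytope m δ ⊆ ⋃ S ∈ regularSimplices m δ f, geomSimplex δ S := by
  intro x hx
  obtain ⟨w, hw⟩ := mem_geomSimplex_iff.1 hx
  obtain ⟨w₀, x₀, hw₀, hpos⟩ := exists_isWeight_pos δ (A := Icc 1 m)
    (nonempty_Icc.2 (by omega))
  have hclosed : IsClosed (⋃ S ∈ regularSimplices m δ f, geomSimplex δ S) :=
    (regularSimplices m δ f).finite_toSet.isClosed_biUnion fun S _ => isClosed_geomSimplex δ S
  have hlim : Tendsto (fun t : ℝ => (1 - t) • x + t • x₀) (𝓝[>] 0) (𝓝 x) := by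
    have : Tendsto (fun t : ℝ => (1 - t) • x + t • x₀) (𝓝 0) (𝓝 ((1 - (0 : ℝ)) • x + (0 : ℝ) • x₀)) :=
      Continuous.tendsto (by fun_prop) 0
    simp only [sub_zero, one_smul, zero_smul, add_zero] at this
    exact this.mono_left nhdsWithin_le_nhds
  refine hclosed.mem_of_tendsto hlim ?_
  filter_upwards [Ioo_mem_nhdsGT (zero_lt_one (α := ℝ))] with t ht
  have hwt : IsWeight δ (Icc 1 m) (fun i => (1 - t) * w i + t * w₀ i) ((1 - t) • x + t • x₀) := by
    refine ⟨fun i => ?_, fun i hi => ?_, ?_, ?_⟩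
    · exact add_nonneg (mul_nonneg (by linarith [ht.2]) (hw.nonneg i))
        (mul_nonneg ht.1.le (hw₀.nonneg i))
    · simp [hw.zero_off i hi, hw₀.zero_off i hi]
    · rw [sum_add_distrib, ← mul_sum, ← mul_sum, hw.sum_one, hw₀.sum_one]
      ring
    · simp only [add_smul, mul_smul, sum_add_distrib, ← smul_sum, hw.sum_eq, hw₀.sum_eq]
  obtain ⟨S, hSm, hS, hsupp, hxS⟩ := exists_isSupported_of_pos hm hf hwt fun i hi =>
    add_pos_of_nonneg_of_pos (mul_nonneg (by linarith [ht.2]) (hw.nonneg i))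
      (mul_pos ht.1 (hpos i hi))
  exact Set.mem_biUnion (mem_coe.2 (mem_regularSimplices.2 ⟨hSm, hS, hsupp⟩)) hxS

theorem geomSimplex_mono {δ : ℕ} {A B : Finset ℕ} (h : A ⊆ B) : geomSimplex δ A ⊆ geomSimplex δ B :=
  convexHull_mono (Set.image_mono (coe_subset.2 h))

/-- The regular triangulation of `C(m, δ)` given by generic heights `f`. -/
noncomputable def regularTriangulation {m δ : ℕ} (hm : δ + 1 ≤ m) {f : ℕ → ℝ}
    (hf : IsGeneric m δ f) : Triangulation m δ where
  simplices := regularSimplices m δ f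
  vertices_subset S hS := (mem_regularSimplices.1 hS).1
  card_eq S hS := (mem_regularSimplices.1 hS).2.1
  cover := Set.Subset.antisymm
    (Set.iUnion₂_subset fun S hS => geomSimplex_mono (mem_regularSimplices.1 hS).1)
    (cyclicPolytope_subset_regularSimplices hm hf)
  inter S hS S' hS' := by
    obtain ⟨hSm, hc, hsupp⟩ := mem_regularSimplices.1 hS
    obtain ⟨hSm', hc', hsupp'⟩ := mem_regularSimplices.1 hS'
    refine Set.Subset.antisymm ?_ (Set.subset_inter (geomSimplex_mono inter_subset_left)
      (geomSimplex_mono inter_subset_right))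
    rintro x ⟨hx, hx'⟩
    obtain ⟨w, hw⟩ := mem_geomSimplex_iff.1 hx
    obtain ⟨w', hw'⟩ := mem_geomSimplex_iff.1 hx'
    refine mem_geomSimplex_iff.2 ⟨w', hw'.of_support fun i hi => ?_⟩
    by_contra hne
    refine hi (mem_inter.2 ⟨hsupp.mem_of_weight_ne_zero hf hSm hc hsupp' hSm' hw hw' hne, ?_⟩)
    by_contra h
    exact hne (hw'.zero_off i h)

theorem exists_superset_regularTriangulation {m δ : ℕ} (hm : δ + 1 ≤ m) {f : ℕ → ℝ}
    (hf : IsGeneric m δ f) {B : Finset ℕ} (hB : B.Nonempty) (hBm : B ⊆ Icc 1 m) :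
    (∃ S ∈ (regularTriangulation hm hf).simplices, B ⊆ S) ↔ IsSupported m δ f B := by
  constructor
  · rintro ⟨S, hS, hBS⟩
    exact (mem_regularSimplices.1 hS).2.2.mono hBS
  · intro hsupp
    obtain ⟨w, x, hw, hpos⟩ := exists_isWeight_pos δ hB
    obtain ⟨S, hS, w', hw'⟩ := (regularTriangulation hm hf).exists_weight
      (mem_geomSimplex_iff.2 ⟨w, hw.mono hBm⟩)
    obtain ⟨hSm, hc, hsupp'⟩ := mem_regularSimplices.1 hS
    exact ⟨S, hS, fun i hi => hsupp'.mem_of_weight_ne_zero hf hSm hc hsupp hBm hw' hw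
      (hpos i hi).ne'⟩

/-! ### Convex heights in general position -/

theorem eventually_notMem_of_finite {s : Set ℝ} (hs : s.Finite) (a : ℝ) :
    ∀ᶠ t in 𝓝[>] a, t ∉ s := by
  have h : ∀ᶠ t in 𝓝 a, t ∉ s \ {a} :=
    (hs.subset Set.sdiff_subset).isClosed.isOpen_compl.mem_nhds fun h => h.2 rfl
  filter_upwards [h.filter_mono nhdsWithin_le_nhds, self_mem_nhdsWithin] with t ht hta hts
  exact ht ⟨hts, (ne_of_gt hta : t ≠ a)⟩

/-- The divided difference of `i ↦ ε ^ i`, as a polynomial in `ε`. -/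
noncomputable def powerDifference (Z : Finset ℕ) : ℝ[X] := ∑ i ∈ Z, C (divWeight Z i) * X ^ i

theorem eval_powerDifference (Z : Finset ℕ) (ε : ℝ) :
    (powerDifference Z).eval ε = dividedDifference (fun i => ε ^ i) Z := by
  simp [powerDifference, dividedDifference, eval_finsetSum]

theorem coeff_powerDifference (Z : Finset ℕ) (k : ℕ) :
    (powerDifference Z).coeff k = if k ∈ Z then divWeight Z k else 0 := by
  simp [powerDifference, finsetSum_coeff, coeff_X_pow]

/-- There are heights whose divided differences at `δ + 3` vertices are positive, and whose divided
differences at different sets of `δ + 2` vertices are different. -/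
theorem exists_convex_heights (m δ : ℕ) : ∃ g : ℕ → ℝ,
    (∀ Z ⊆ Icc 1 m, #Z = δ + 3 → 0 < dividedDifference g Z) ∧
    ∀ Z ⊆ Icc 1 m, #Z = δ + 2 → ∀ Z' ⊆ Icc 1 m, #Z' = δ + 2 →
      dividedDifference g Z = dividedDifference g Z' → Z = Z' := by
  -- The heights are `i ^ (δ + 2)`, whose divided differences at `δ + 3` points equal `1`, perturbed
  -- by `ε ^ i` for small `ε`.
  have hsplit : ∀ (ε : ℝ) Z, dividedDifference (fun i : ℕ => (i : ℝ) ^ (δ + 2) + ε ^ i) Z =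
      dividedDifference (fun i : ℕ => (i : ℝ) ^ (δ + 2)) Z + (powerDifference Z).eval ε :=
    fun ε Z => by rw [dividedDifference_add, eval_powerDifference]
  have h1 : ∀ᶠ ε in 𝓝[>] (0 : ℝ), ∀ Z ∈ powersetCard (δ + 3) (Icc 1 m),
      0 < dividedDifference (fun i : ℕ => (i : ℝ) ^ (δ + 2) + ε ^ i) Z := by
    rw [eventually_all_finset]
    intro Z hZ
    obtain ⟨hZm, hZ⟩ := mem_powersetCard.1 hZ
    have h0 : (0 : ℕ) ∉ Z := fun h => by simpa using hZm h
    have hpow : dividedDifference (fun i : ℕ => (i : ℝ) ^ (δ + 2)) Z = 1 := by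
      have := dividedDifference_eval (Z := Z) (Q := X ^ (δ + 2)) (by simp [hZ])
      simpa [hZ] using this
    have hlim : Tendsto (fun ε => 1 + (powerDifference Z).eval ε) (𝓝 0)
        (𝓝 (1 + (powerDifference Z).eval 0)) := Continuous.tendsto (by fun_prop) 0
    rw [← coeff_zero_eq_eval_zero, coeff_powerDifference, if_neg h0, add_zero] at hlim
    filter_upwards [(hlim.eventually (lt_mem_nhds zero_lt_one)).filter_mono nhdsWithin_le_nhds]
      with ε hε
    rwa [hsplit, hpow]
  have h2 : ∀ᶠ ε in 𝓝[>] (0 : ℝ), ∀ Z ∈ powersetCard (δ + 2) (Icc 1 m),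
      ∀ Z' ∈ powersetCard (δ + 2) (Icc 1 m),
      dividedDifference (fun i : ℕ => (i : ℝ) ^ (δ + 2) + ε ^ i) Z =
        dividedDifference (fun i : ℕ => (i : ℝ) ^ (δ + 2) + ε ^ i) Z' → Z = Z' := by
    rw [eventually_all_finset]
    intro Z hZ
    rw [eventually_all_finset]
    intro Z' hZ'
    obtain ⟨hZm, hZ⟩ := mem_powersetCard.1 hZ
    obtain ⟨hZm', hZ'⟩ := mem_powersetCard.1 hZ'
    by_cases hne : Z = Z'
    · exact Eventually.of_forall fun _ _ => hne
    obtain ⟨k, hk, hk'⟩ : ∃ k ∈ Z, k ∉ Z' := by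
      by_contra hcon
      push Not at hcon
      exact hne (eq_of_subset_of_card_le hcon (by omega))
    -- The difference of the two divided differences is a polynomial in `ε`, nonzero because of its
    -- coefficient at an index `k` in `Z` but not in `Z'`; small `ε` avoid its roots.
    let P : ℝ[X] := C (dividedDifference (fun i : ℕ => (i : ℝ) ^ (δ + 2)) Z -
      dividedDifference (fun i : ℕ => (i : ℝ) ^ (δ + 2)) Z') +
        (powerDifference Z - powerDifference Z')
    have hP : P ≠ 0 := by
      intro h
      have hk0 : k ≠ 0 := by
        have := mem_Icc.1 (hZm hk)
        omega
      have := congrArg (fun Q => Q.coeff k) h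
      simp only [P, coeff_add, coeff_sub, coeff_powerDifference, coeff_C, hk0, hk, hk', if_true,
        if_false, coeff_zero, zero_add, sub_zero] at this
      exact divWeight_ne_zero hk this
    filter_upwards [eventually_notMem_of_finite P.roots.toFinset.finite_toSet 0] with ε hε heq
    refine absurd ?_ hε
    rw [hsplit, hsplit] at heq
    simp only [mem_coe, Multiset.mem_toFinset, mem_roots hP, IsRoot.def, P, eval_add, eval_C,
      eval_sub]
    linarith
  obtain ⟨ε, h1, h2⟩ := (h1.and h2).exists
  exact ⟨_, fun Z hZm hZ => h1 Z (mem_powersetCard.2 ⟨hZm, hZ⟩), fun Z hZm hZ Z' hZm' hZ' =>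
    h2 Z (mem_powersetCard.2 ⟨hZm, hZ⟩) Z' (mem_powersetCard.2 ⟨hZm', hZ'⟩)⟩

/-- If the divided differences of `f` at `δ + 3` vertices are positive, then the polynomial which
interpolates `f` at `δ + 2` vertices satisfying Gale's evenness condition lies below `f`. -/
theorem exists_interpolation_le {m δ : ℕ} {f : ℕ → ℝ}
    (hf : ∀ Z ⊆ Icc 1 m, #Z = δ + 3 → 0 < dividedDifference f Z) {Z : Finset ℕ}
    (hZm : Z ⊆ Icc 1 m) (hZ : #Z = δ + 2) (hprod : ∀ j ∈ Icc 1 m, 0 ≤ ∏ s ∈ Z, ((j : ℝ) - s)) :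
    ∃ r : ℝ[X], r.natDegree ≤ δ + 1 ∧ r.coeff (δ + 1) = dividedDifference f Z ∧
      (∀ i ∈ Icc 1 m, r.eval (i : ℝ) ≤ f i) ∧ ∀ i ∈ Z, r.eval (i : ℝ) = f i := by
  have hinj : Set.InjOn (fun j : ℕ => (j : ℝ)) Z := Nat.cast_injective.injOn
  set r := Lagrange.interpolate Z (fun j : ℕ => (j : ℝ)) f with hr
  have hreq : ∀ i ∈ Z, r.eval (i : ℝ) = f i := fun i hi =>
    Lagrange.eval_interpolate_at_node (v := fun j : ℕ => (j : ℝ)) f hinj hi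
  have hdeg : r.natDegree ≤ δ + 1 := by
    have := Lagrange.degree_interpolate_lt f hinj
    rw [← hr, hZ] at this
    exact natDegree_le_iff_coeff_eq_zero.2 fun N hN =>
      coeff_eq_zero_of_degree_lt (this.trans_le (by exact_mod_cast hN))
  refine ⟨r, hdeg, ?_, fun i hi => ?_, hreq⟩
  · rw [← dividedDifference_congr hreq, dividedDifference_eval (by omega), hZ]
    rfl
  · by_cases hiZ : i ∈ Z
    · exact (hreq i hiZ).le
    have hcard : #(insert i Z) = δ + 3 := by rw [card_insert_of_notMem hiZ, hZ]
    have h1 := hf (insert i Z) (insert_subset hi hZm) hcard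
    -- Subtracting `r` leaves the divided difference unchanged, and only the term at `i` survives;
    -- its weight is the inverse of the Gale product.
    have h2 : dividedDifference (fun j => f j - r.eval (j : ℝ)) (insert i Z) =
        dividedDifference f (insert i Z) := by
      rw [dividedDifference_sub, dividedDifference_eval_eq_zero (by omega), sub_zero]
    rw [← h2, dividedDifference, sum_insert hiZ,
      sum_eq_zero fun j hj => by rw [hreq j hj, sub_self, mul_zero], add_zero] at h1
    have h3 : 0 ≤ divWeight (insert i Z) i := by
      rw [divWeight, Lagrange.nodalWeight, erase_insert hiZ, prod_inv_distrib]
      exact inv_nonneg.2 (hprod i hi)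
    linarith [pos_of_mul_pos_right h1 h3]

theorem IsDecreasing.dividedDifference_nonneg {n : ℕ} {z : ℕ → ℕ} (hz : IsDecreasing n z)
    {h : ℕ → ℝ} (h1 : ∀ i < n, Even i → 0 ≤ h (z i)) (h2 : ∀ i < n, Odd i → h (z i) ≤ 0) :
    0 ≤ dividedDifference h ((range n).image z) := by
  refine sum_nonneg fun k hk => ?_
  obtain ⟨i, hi, rfl⟩ := mem_image.1 hk
  rw [mem_range] at hi
  have hsign := hz.divWeight_sign hi
  rcases Nat.even_or_odd i with he | ho
  · rw [he.neg_one_pow, one_mul] at hsign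
    exact mul_nonneg hsign.le (h1 i hi he)
  · rw [ho.neg_one_pow, neg_one_mul, neg_pos] at hsign
    exact mul_nonneg_of_nonpos_of_nonpos hsign.le (h2 i hi ho)

theorem prod_union_image_nonneg {A : Finset ℕ} {φ : ℕ → ℕ} (hφ : Set.InjOn φ A)
    (hdisj : Disjoint A (A.image φ)) (h : ∀ a ∈ A, φ a = a + 1 ∨ φ a + 1 = a) (j : ℕ) :
    0 ≤ ∏ s ∈ A ∪ A.image φ, ((j : ℝ) - s) := by
  rw [prod_union hdisj, prod_image hφ, ← prod_mul_distrib]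
  refine prod_nonneg fun a ha => ?_
  have key : ∀ b : ℕ, 0 ≤ ((j : ℝ) - b) * ((j : ℝ) - ((b + 1 : ℕ) : ℝ)) := by
    intro b
    rcases le_or_gt j b with hjb | hjb
    · have : (j : ℝ) ≤ b := by exact_mod_cast hjb
      exact mul_nonneg_of_nonpos_of_nonpos (by linarith) (by push_cast; linarith)
    · have : ((b + 1 : ℕ) : ℝ) ≤ j := by exact_mod_cast hjb
      exact mul_nonneg (by push_cast at this; linarith) (by linarith)
  rcases h a ha with h | h
  · rw [h]
    exact key a
  · have h1 := key (φ a)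
    rwa [h, mul_comm] at h1

/-! ### The Gale-even set attached to a separated set -/

theorem two_le_of_mem_innerSeparated {m d : ℕ} {A : Finset ℕ} (hA : A ∈ innerSeparated m d) :
    ∀ a ∈ A, 2 ≤ a := by
  obtain ⟨hAm, -, -, h1, -⟩ := mem_innerSeparated.1 hA
  intro a ha
  have h2 := mem_Icc.1 (hAm ha)
  have h3 : a ≠ 1 := fun h => h1 (h ▸ ha)
  omega

theorem prod_union_succ_nonneg {m d : ℕ} {B : Finset ℕ} (hB : B ∈ innerSeparated m d) (j : ℕ) :
    0 ≤ ∏ s ∈ B ∪ B.image (· + 1), ((j : ℝ) - s) := by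
  obtain ⟨-, -, hsep, -, -⟩ := mem_innerSeparated.1 hB
  refine prod_union_image_nonneg (add_left_injective 1).injOn ?_ (fun a _ => Or.inl rfl) j
  refine disjoint_left.2 fun a ha ha' => ?_
  obtain ⟨b, hb, rfl⟩ := mem_image.1 ha'
  have := hsep b hb (b + 1) ha (by omega)
  omega

theorem prod_union_pred_nonneg {m d : ℕ} {A : Finset ℕ} (hA : A ∈ innerSeparated m d) (j : ℕ) :
    0 ≤ ∏ s ∈ A ∪ A.image (· - 1), ((j : ℝ) - s) := by
  obtain ⟨-, -, hsep, -, -⟩ := mem_innerSeparated.1 hA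
  have h2 := two_le_of_mem_innerSeparated hA
  refine prod_union_image_nonneg (fun a ha b hb hab => ?_) ?_ (fun a ha => Or.inr ?_) j
  · have := h2 a ha
    have := h2 b hb
    omega
  · refine disjoint_left.2 fun a ha ha' => ?_
    obtain ⟨b, hb, rfl⟩ := mem_image.1 ha'
    have := h2 b hb
    have := hsep (b - 1) ha b hb (by omega)
    omega
  · have := h2 a ha
    omega

/-- At the greatest `a` in `A` but not in `A'`, separation forces `a + 1 ∈ A'` and then `a + 2 ∈ A`,
while `a + 2 ∉ A'`, against maximality. -/
theorem injOn_union_pred (m d : ℕ) :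
    Set.InjOn (fun A : Finset ℕ => A ∪ A.image (· - 1)) (innerSeparated m d) := by
  have key : ∀ A ∈ innerSeparated m d, ∀ A' ∈ innerSeparated m d,
      A ∪ A.image (· - 1) = A' ∪ A'.image (· - 1) → A ⊆ A' := by
    intro A hA A' hA' heq
    have hsep := (mem_innerSeparated.1 hA).2.2.1
    have hsep' := (mem_innerSeparated.1 hA').2.2.1
    by_contra hcon
    obtain ⟨a, ha, hmax⟩ := (A \ A').exists_max_image id (sdiff_nonempty.2 hcon)
    obtain ⟨haA, haA'⟩ := mem_sdiff.1 ha
    have hsucc : a + 1 ∈ A' := by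
      have h1 : a ∈ A' ∪ A'.image (· - 1) := heq ▸ mem_union_left _ haA
      obtain ⟨b, hb, rfl⟩ := mem_image.1 ((mem_union.1 h1).resolve_left haA')
      have := two_le_of_mem_innerSeparated hA' b hb
      rwa [Nat.sub_add_cancel (by omega)]
    have h1 : a + 1 ∈ A ∪ A.image (· - 1) := heq ▸ mem_union_left _ hsucc
    rcases mem_union.1 h1 with h1 | h1
    · have := hsep a haA (a + 1) h1 (by omega)
      omega
    · obtain ⟨b, hb, hba⟩ := mem_image.1 h1
      have h2 := two_le_of_mem_innerSeparated hA b hb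
      by_cases hbA' : b ∈ A'
      · have := hsep' (a + 1) hsucc b hbA' (by omega)
        omega
      · have := hmax b (mem_sdiff.2 ⟨hb, hbA'⟩)
        simp only [id_eq] at this
        omega
  intro A hA A' hA' heq
  exact (key A hA A' hA' heq).antisymm (key A' hA' A hA heq.symm)

theorem injOn_insert_union_succ (m d : ℕ) :
    Set.InjOn (fun B : Finset ℕ => insert 1 (B ∪ B.image (· + 1))) (innerSeparated m d) := by
  have key : ∀ B ∈ innerSeparated m d, ∀ B' ∈ innerSeparated m d,
      insert 1 (B ∪ B.image (· + 1)) = insert 1 (B' ∪ B'.image (· + 1)) → B ⊆ B' := by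
    intro B hB B' hB' heq
    have hsep := (mem_innerSeparated.1 hB).2.2.1
    have hsep' := (mem_innerSeparated.1 hB').2.2.1
    by_contra hcon
    obtain ⟨b, hb, hmin⟩ := (B \ B').exists_min_image id (sdiff_nonempty.2 hcon)
    obtain ⟨hbB, hbB'⟩ := mem_sdiff.1 hb
    have hb2 := two_le_of_mem_innerSeparated hB b hbB
    have h1 : b ∈ insert 1 (B' ∪ B'.image (· + 1)) :=
      heq ▸ mem_insert_of_mem (mem_union_left _ hbB)
    rcases mem_insert.1 h1 with h1 | h1
    · omega
    obtain ⟨c, hc, rfl⟩ := mem_image.1 ((mem_union.1 h1).resolve_left hbB')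
    have hc2 := two_le_of_mem_innerSeparated hB' c hc
    have h2 : c ∈ insert 1 (B ∪ B.image (· + 1)) :=
      heq ▸ mem_insert_of_mem (mem_union_left _ hc)
    rcases mem_insert.1 h2 with h2 | h2
    · omega
    rcases mem_union.1 h2 with h2 | h2
    · have := hsep c h2 (c + 1) hbB (by omega)
      omega
    · obtain ⟨e, he, rfl⟩ := mem_image.1 h2
      by_cases heB' : e ∈ B'
      · have := hsep' e heB' (e + 1) hc (by omega)
        omega
      · have := hmin e (mem_sdiff.2 ⟨he, heB'⟩)
        simp only [id_eq] at this
        omega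
  intro B hB B' hB' heq
  exact (key B hB B' hB' heq).antisymm (key B' hB' B hB heq.symm)

/-! ### Membership decided by the sign of one divided difference -/

/-- If `ℓ` supports `B`, then `f - ℓ` is nonnegative and zero on the odd class, so its divided
difference, that of `f`, is nonnegative. Conversely, the interpolant `r` lies below `f`; subtracting
`c` times the nonnegative nodal polynomial of `B ∪ (B + 1)` cancels its leading term and keeps it
touching on `B`. -/
theorem isSupported_iff_dividedDifference_pos {m d : ℕ} {f : ℕ → ℝ}
    (hf : ∀ Z ⊆ Icc 1 m, #Z = 2 * d + 1 + 3 → 0 < dividedDifference f Z)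
    (hgen : IsGeneric m (2 * d + 1) f) {B : Finset ℕ} (hB : B ∈ innerSeparated m d) :
    IsSupported m (2 * d + 1) f B ↔
      0 < dividedDifference f (insert 1 (B ∪ B.image (· + 1))) := by
  obtain ⟨z, hz, hzm, hodd, hZ⟩ := exists_isDecreasing_odd hB
  have hZcard : #(insert 1 (B ∪ B.image (· + 1))) = 2 * d + 3 := by rw [← hZ, hz.card_image]
  have hZm : insert 1 (B ∪ B.image (· + 1)) ⊆ Icc 1 m := by
    rw [← hZ]
    intro k hk
    obtain ⟨i, hi, rfl⟩ := mem_image.1 hk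
    exact hzm i (mem_range.1 hi)
  have h1B : 1 ∉ B ∪ B.image (· + 1) := by
    intro h
    rcases mem_union.1 h with h | h
    · have := two_le_of_mem_innerSeparated hB 1 h
      omega
    · obtain ⟨b, hb, hb1⟩ := mem_image.1 h
      have := two_le_of_mem_innerSeparated hB b hb
      omega
  constructor
  · rintro ⟨ℓ, hdeg, hle, heq⟩
    refine lt_of_le_of_ne ?_ (hgen _ hZm hZcard).symm
    have h1 := hz.dividedDifference_nonneg (h := fun i => f i - ℓ.eval (i : ℝ))
      (fun i hi _ => sub_nonneg.2 (hle _ (hzm i hi)))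
      (fun i hi ho => by rw [heq _ (hodd i hi ho), sub_self])
    rw [hZ, dividedDifference_sub, dividedDifference_eval_eq_zero (by omega), sub_zero] at h1
    exact h1
  · intro hpos
    have hcardE : #(B ∪ B.image (· + 1)) = 2 * d + 2 := by
      rw [card_insert_of_notMem h1B] at hZcard
      omega
    obtain ⟨r, hrdeg, hrc, hrle, hreq⟩ := exists_interpolation_le hf hZm hZcard fun j hj => by
      rw [prod_insert h1B]
      have : (1 : ℝ) ≤ j := by exact_mod_cast (mem_Icc.1 hj).1
      exact mul_nonneg (by simpa using this) (prod_union_succ_nonneg hB j)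
    set c := dividedDifference f (insert 1 (B ∪ B.image (· + 1))) with hc
    set E := B ∪ B.image (· + 1) with hE
    set Q : ℝ[X] := Lagrange.nodal E fun j : ℕ => (j : ℝ) with hQ
    have hQdeg : Q.natDegree = 2 * d + 1 + 1 := by rw [hQ, Lagrange.natDegree_nodal, hcardE]
    have hQc : Q.coeff (2 * d + 1 + 1) = 1 := by
      rw [← hQdeg]
      exact Lagrange.nodal_monic
    refine ⟨r - C c * Q, ?_, fun i hi => ?_, fun i hi => ?_⟩
    · have h1 : (r - C c * Q).natDegree ≤ 2 * d + 1 + 1 :=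
        (natDegree_sub_le _ _).trans (max_le hrdeg ((natDegree_C_mul_le _ _).trans hQdeg.le))
      refine natDegree_le_iff_coeff_eq_zero.2 fun N hN => ?_
      rcases (Nat.succ_le_of_lt hN).eq_or_lt with h | h
      · rw [← h, coeff_sub, coeff_C_mul]
        change r.coeff (2 * d + 1 + 1) - c * Q.coeff (2 * d + 1 + 1) = 0
        rw [hrc, hQc, mul_one, sub_self]
      · exact coeff_eq_zero_of_natDegree_lt (h1.trans_lt h)
    · have h1 := prod_union_succ_nonneg hB i
      rw [← hE, ← eval_nodal_natCast, ← hQ] at h1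
      have := mul_nonneg hpos.le h1
      simp only [eval_sub, eval_mul, eval_C]
      linarith [hrle i hi]
    · have h1 : Q.eval (i : ℝ) = 0 :=
        Lagrange.eval_nodal_at_node (v := fun j : ℕ => (j : ℝ)) (mem_union_left _ hi)
      simp only [eval_sub, eval_mul, eval_C, h1, mul_zero, sub_zero]
      exact hreq i (mem_insert_of_mem (mem_union_left _ hi))

/-- Let `r` interpolate `f` on `A ∪ (A - 1)` and let `ℓ` support a simplex `S`. Then `r ≥ ℓ` on `A`
and `r ≤ ℓ` on `S`, and the leading coefficient of `r - ℓ` is the divided difference of `f`. An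
alternation of `A` with `S`, or of `S` with `A`, therefore fixes its sign. -/
theorem submerges_iff_dividedDifference_neg {m d : ℕ} (hm : 2 * d + 1 ≤ m) {f : ℕ → ℝ}
    (hf : ∀ Z ⊆ Icc 1 m, #Z = 2 * d + 3 → 0 < dividedDifference f Z)
    (hgen : IsGeneric m (2 * d) f) {A : Finset ℕ} (hA : A ∈ innerSeparated (m + 1) d) :
    (regularTriangulation hm hgen).Submerges A ↔
      dividedDifference f (A ∪ A.image (· - 1)) < 0 := by
  obtain ⟨z, hz, hzm, heven, -, hZ⟩ := exists_isDecreasing_even hA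
  have hcard := (mem_innerSeparated.1 hA).2.1
  have hAm := subset_Icc_of_mem_innerSeparated hA
  have hZcard : #(A ∪ A.image (· - 1)) = 2 * d + 2 := by rw [← hZ, hz.card_image]
  have hZm : A ∪ A.image (· - 1) ⊆ Icc 1 m := by
    rw [← hZ]
    intro k hk
    obtain ⟨i, hi, rfl⟩ := mem_image.1 hk
    exact hzm i (mem_range.1 hi)
  obtain ⟨r, hrdeg, hrc, hrle, hreq⟩ := exists_interpolation_le hf hZm hZcard fun j _ =>
    prod_union_pred_nonneg hA j
  have hdd : ∀ ℓ : ℝ[X], ℓ.natDegree ≤ 2 * d → ∀ y, IsDecreasing (2 * d + 2) y →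
      dividedDifference (fun i => r.eval (i : ℝ) - ℓ.eval (i : ℝ)) ((range (2 * d + 2)).image y) =
        dividedDifference f (A ∪ A.image (· - 1)) := by
    intro ℓ hℓ y hy
    rw [dividedDifference_sub, dividedDifference_eval (by rw [hy.card_image]; omega),
      dividedDifference_eval_eq_zero (by rw [hy.card_image]; omega), hy.card_image, sub_zero, ← hrc]
    rfl
  constructor
  · intro hsub
    by_contra hneg
    have hpos := lt_of_le_of_ne (not_lt.1 hneg) (hgen _ hZm hZcard).symm
    have hcontra : ∀ ℓ : ℝ[X], ℓ.natDegree ≤ 2 * d → ∀ y, IsDecreasing (2 * d + 2) y →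
        (∀ i < 2 * d + 2, Even i → r.eval (y i : ℝ) ≤ ℓ.eval (y i : ℝ)) →
        (∀ i < 2 * d + 2, Odd i → ℓ.eval (y i : ℝ) ≤ r.eval (y i : ℝ)) → False := by
      intro ℓ hℓ y hy h1 h2
      have h3 := hy.dividedDifference_nonneg
        (h := fun i => (-1) * (r.eval (i : ℝ) - ℓ.eval (i : ℝ)))
        (fun i hi he => by have := h1 i hi he; linarith)
        (fun i hi ho => by have := h2 i hi ho; linarith)
      rw [dividedDifference_const_mul, hdd ℓ hℓ y hy] at h3
      linarith
    obtain ⟨w, x, hw, hwpos⟩ := exists_isWeight_pos (2 * d) (A := A) (card_pos.1 (by omega))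
    obtain ⟨S, hS, w', hw'⟩ := (regularTriangulation hm hgen).exists_weight
      (mem_geomSimplex_iff.2 ⟨w, hw.mono hAm⟩)
    obtain ⟨hSm, -, ℓ, hℓ, hℓle, hℓeq⟩ := mem_regularSimplices.1 hS
    -- If `A ⊆ S`, the alternation of `A` with `A - 1` gives the contradiction; otherwise submersion
    -- makes `S` alternate with `A`.
    by_cases hne : w = w'
    · subst hne
      have hAS : A ⊆ S := fun i hi => by
        by_contra hcon
        exact (hwpos i hi).ne' (hw'.zero_off i hcon)
      refine hcontra ℓ hℓ z hz (fun i hi he => ?_) fun i hi _ => ?_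
      · rw [hℓeq _ (hAS (heven i hi he))]
        exact hrle _ (hzm i hi)
      · rw [hreq (z i) (hZ ▸ mem_image_of_mem z (mem_range.2 hi))]
        exact hℓle _ (hzm i hi)
    · have hle := hsub x (mem_geomSimplex_iff.2 ⟨w, hw⟩)
      rw [sectionHeight_singleton (by omega) hw,
        (regularTriangulation hm hgen).sectionHeight_eq hS hw'] at hle
      obtain ⟨y, hy, hyS, hyA⟩ := hw'.alternates hw (Ne.symm hne) hle
      refine hcontra ℓ hℓ y hy (fun i hi he => ?_) fun i hi ho => ?_
      · rw [hℓeq _ (hyS i hi he)]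
        exact hrle _ (hSm (hyS i hi he))
      · rw [hreq _ (mem_union_left _ (hyA i hi ho))]
        exact hℓle _ (hAm (hyA i hi ho))
  · intro hneg
    rw [Triangulation.submerges_iff _ (by omega) hAm]
    rintro S hS ⟨y, hy, hyA, hyS⟩
    obtain ⟨hSm, -, ℓ, hℓ, hℓle, hℓeq⟩ := mem_regularSimplices.1 hS
    have h1 := hy.dividedDifference_nonneg
      (h := fun i => r.eval (i : ℝ) - ℓ.eval (i : ℝ))
      (fun i hi he => by
        rw [hreq _ (mem_union_left _ (hyA i hi he))]
        exact sub_nonneg.2 (hℓle _ (hAm (hyA i hi he))))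
      (fun i hi ho => by
        rw [hℓeq _ (hyS i hi ho)]
        exact sub_nonpos.2 (hrle _ (hSm (hyS i hi ho))))
    rw [hdd ℓ hℓ y hy] at h1
    linarith

/-! ### The pencil of heights and the minimality bounds -/

/-- The heights `t i ^ (δ + 1) + g i`. -/
def pencilHeights (δ : ℕ) (g : ℕ → ℝ) (t : ℝ) (i : ℕ) : ℝ := t * (i : ℝ) ^ (δ + 1) + g i

theorem dividedDifference_pencilHeights {δ : ℕ} (g : ℕ → ℝ) (t : ℝ) {Z : Finset ℕ}
    (hZ : #Z = δ + 2) :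
    dividedDifference (pencilHeights δ g t) Z = t + dividedDifference g Z := by
  have h := dividedDifference_eval (Z := Z) (Q := X ^ (δ + 1)) (by simp [hZ])
  simp only [eval_pow, eval_X, hZ, coeff_X_pow] at h
  change dividedDifference (fun i => t * (i : ℝ) ^ (δ + 1) + g i) Z = _
  rw [dividedDifference_add, dividedDifference_const_mul, h]
  simp

theorem dividedDifference_pencilHeights_of_card {δ : ℕ} (g : ℕ → ℝ) (t : ℝ) {Z : Finset ℕ}
    (hZ : #Z = δ + 3) :
    dividedDifference (pencilHeights δ g t) Z = dividedDifference g Z := by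
  have h := dividedDifference_eval_eq_zero (Z := Z) (Q := X ^ (δ + 1)) (by simp [hZ])
  simp only [eval_pow, eval_X] at h
  change dividedDifference (fun i => t * (i : ℝ) ^ (δ + 1) + g i) Z = _
  rw [dividedDifference_add, dividedDifference_const_mul, h]
  simp

theorem finite_not_isGeneric_pencilHeights (m δ : ℕ) (g : ℕ → ℝ) :
    {t | ¬ IsGeneric m δ (pencilHeights δ g t)}.Finite := by
  refine ((powersetCard (δ + 2) (Icc 1 m)).image fun Z => -dividedDifference g Z).finite_toSet.subset
    fun t ht => ?_
  simp only [Set.mem_ofPred_eq, IsGeneric] at ht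
  push Not at ht
  obtain ⟨Z, hZm, hZ, h0⟩ := ht
  rw [dividedDifference_pencilHeights g t hZ] at h0
  exact mem_coe.2 (mem_image.2 ⟨Z, mem_powersetCard.2 ⟨hZm, hZ⟩, by linarith⟩)

/-- A chain of subsets of an `N`-element set, indexed by almost all real numbers, which decreases
strictly at each of the numbers `τ i`. -/
theorem card_le_of_chain {I : Type*} [Fintype I] {N : ℕ} {τ : I → ℝ} (hτ : Function.Injective τ)
    {bad : Set ℝ} (hbad : bad.Finite) (F : ℝ → Finset (Fin N))
    (hF : ∀ s ∉ bad, ∀ t ∉ bad, F s ⊆ F t ↔ ∀ i, s < τ i → t < τ i) : Fintype.card I ≤ N := by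
  classical
  -- Passing from `t` to just beyond the next `τ i` drops exactly one index and at least one element
  -- of `F`.
  have key : ∀ n, ∀ t ∉ bad, #(univ.filter fun i => t < τ i) = n → n ≤ #(F t) := by
    intro n
    induction n with
    | zero => exact fun t _ _ => Nat.zero_le _
    | succ n ih =>
      intro t ht hcard
      obtain ⟨i, hi, hmin⟩ := (univ.filter fun i => t < τ i).exists_min_image τ
        (card_pos.1 (by omega))
      have hti : t < τ i := (mem_filter.1 hi).2
      have hnext : ∀ᶠ t' in 𝓝[>] τ i, ∀ j, τ i < τ j → t' < τ j := by
        rw [eventually_all]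
        intro j
        by_cases h : τ i < τ j
        · exact ((gt_mem_nhds h).filter_mono nhdsWithin_le_nhds).mono fun _ h _ => h
        · exact Eventually.of_forall fun _ h' => absurd h' h
      obtain ⟨t', ⟨hlt, hbad'⟩, hit'⟩ := ((hnext.and (eventually_notMem_of_finite hbad (τ i))).and
        self_mem_nhdsWithin).exists
      have hfilter : (univ.filter fun j => t' < τ j) = (univ.filter fun j => t < τ j).erase i := by
        ext j
        simp only [mem_filter, mem_univ, true_and, mem_erase]
        constructor
        · intro hj
          refine ⟨?_, by linarith⟩
          rintro rfl
          linarith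
        · rintro ⟨hji, hj⟩
          exact hlt j (lt_of_le_of_ne (hmin j (by simpa using hj)) fun h => hji (hτ h).symm)
      have h1 := ih t' hbad' (by rw [hfilter, card_erase_of_mem hi, hcard]; rfl)
      have h2 : F t' ⊂ F t := by
        refine ⟨(hF t' hbad' t ht).2 fun j hj => by linarith, fun h => ?_⟩
        have := (hF t ht t' hbad').1 h i hti
        linarith
      have := card_lt_card h2
      omega
  obtain ⟨b, hb⟩ := (hbad.union (Set.finite_range τ)).bddBelow
  have hbτ : ∀ i, b - 1 < τ i := fun i => by
    have := hb (Or.inr ⟨i, rfl⟩)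
    linarith
  have h1 := key _ (b - 1) (fun h => by
    have := hb (Or.inl h)
    linarith) rfl
  rw [filter_true_of_mem fun i _ => hbτ i, card_univ] at h1
  exact h1.trans ((card_le_univ _).trans (Fintype.card_fin N).le)

theorem card_le_of_orderEmbedding_odd {m d N : ℕ} (hm : 2 * d + 2 ≤ m)
    (ι : Triangulation m (2 * d + 1) ↪o (Finset (Fin N))ᵒᵈ) : #(innerSeparated m d) ≤ N := by
  classical
  obtain ⟨g, hg, hginj⟩ := exists_convex_heights m (2 * d + 1)
  have hZ : ∀ B ∈ innerSeparated m d, insert 1 (B ∪ B.image (· + 1)) ⊆ Icc 1 m ∧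
      #(insert 1 (B ∪ B.image (· + 1))) = 2 * d + 1 + 2 := by
    intro B hB
    obtain ⟨z, hz, hzm, -, hZ⟩ := exists_isDecreasing_odd hB
    rw [← hZ]
    refine ⟨fun k hk => ?_, hz.card_image⟩
    obtain ⟨i, hi, rfl⟩ := mem_image.1 hk
    exact hzm i (mem_range.1 hi)
  -- The parameter is `-t` because here membership means a positive divided difference; the sets
  -- then shrink as `t` grows, as `card_le_of_chain` requires.
  have hmem : ∀ t (ht : IsGeneric m (2 * d + 1) (pencilHeights (2 * d + 1) g (-t))),
      ∀ B ∈ innerSeparated m d, B ∈ (regularTriangulation hm ht).internalFaces d ↔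
        t < dividedDifference g (insert 1 (B ∪ B.image (· + 1))) := by
    intro t ht B hB
    rw [Triangulation.mem_internalFaces, internalSimplices_eq_innerSeparated hm,
      exists_superset_regularTriangulation hm ht (card_pos.1 (by
        rw [(mem_innerSeparated.1 hB).2.1]; omega)) (mem_innerSeparated.1 hB).1,
      isSupported_iff_dividedDifference_pos (fun Z hZm hZ => by
        rw [dividedDifference_pencilHeights_of_card g _ hZ]; exact hg Z hZm hZ) ht hB,
      dividedDifference_pencilHeights g _ (hZ B hB).2]
    simp only [hB, true_and]
    constructor <;> intro h <;> linarith
  rw [← Fintype.card_coe]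
  refine card_le_of_chain
    (τ := fun B : innerSeparated m d => dividedDifference g (insert 1 ((B : Finset ℕ) ∪
      (B : Finset ℕ).image (· + 1)))) (fun B B' h => ?_)
    (bad := {t | ¬ IsGeneric m (2 * d + 1) (pencilHeights (2 * d + 1) g (-t))})
    ((finite_not_isGeneric_pencilHeights m (2 * d + 1) g).preimage neg_injective.injOn)
    (fun t => if ht : IsGeneric m (2 * d + 1) (pencilHeights (2 * d + 1) g (-t)) then
      OrderDual.ofDual (ι (regularTriangulation hm ht)) else ∅) fun s hs t ht => ?_
  · exact Subtype.ext (injOn_insert_union_succ m d B.2 B'.2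
      (hginj _ (hZ B B.2).1 (hZ B B.2).2 _ (hZ B' B'.2).1 (hZ B' B'.2).2 h))
  · have hs' := not_not.1 hs
    have ht' := not_not.1 ht
    simp only [hs', ht', dif_pos]
    change ι (regularTriangulation hm ht') ≤ ι (regularTriangulation hm hs') ↔ _
    rw [ι.le_iff_le, le_iff_internalFaces_subset hm]
    constructor
    · intro h B hB
      exact (hmem t ht' B B.2).1 (h ((hmem s hs' B B.2).2 hB))
    · intro h B hB
      have hBI : B ∈ innerSeparated m d := by
        rw [← internalSimplices_eq_innerSeparated hm]
        exact (Triangulation.mem_internalFaces.1 hB).1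
      exact (hmem t ht' B hBI).2 (h ⟨B, hBI⟩ ((hmem s hs' B hBI).1 hB))

theorem card_le_of_orderEmbedding_even {m d N : ℕ} (hm : 2 * d + 1 ≤ m)
    (ι : Triangulation m (2 * d) ↪o Finset (Fin N)) : #(innerSeparated (m + 1) d) ≤ N := by
  classical
  obtain ⟨g, hg, hginj⟩ := exists_convex_heights m (2 * d)
  have hZ : ∀ A ∈ innerSeparated (m + 1) d, A ∪ A.image (· - 1) ⊆ Icc 1 m ∧
      #(A ∪ A.image (· - 1)) = 2 * d + 2 := by
    intro A hA
    obtain ⟨z, hz, hzm, -, -, hZ⟩ := exists_isDecreasing_even hA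
    rw [← hZ]
    refine ⟨fun k hk => ?_, hz.card_image⟩
    obtain ⟨i, hi, rfl⟩ := mem_image.1 hk
    exact hzm i (mem_range.1 hi)
  have hmem : ∀ t (ht : IsGeneric m (2 * d) (pencilHeights (2 * d) g t)),
      ∀ A ∈ innerSeparated (m + 1) d,
        A ∈ (regularTriangulation hm ht).submersionSet d ∩ internalNonLowerSimplices m (2 * d) d ↔
          t < -dividedDifference g (A ∪ A.image (· - 1)) := by
    intro t ht A hA
    rw [mem_inter, Triangulation.mem_submersionSet, internalNonLowerSimplices_eq_innerSeparated hm,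
      submerges_iff_dividedDifference_neg hm (fun Z hZm hZ => by
        rw [dividedDifference_pencilHeights_of_card g _ hZ]; exact hg Z hZm hZ) ht hA,
      dividedDifference_pencilHeights g _ (hZ A hA).2]
    simp only [hA, subset_Icc_of_mem_innerSeparated hA, (mem_innerSeparated.1 hA).2.1, true_and,
      and_true]
    constructor <;> intro h <;> linarith
  rw [← Fintype.card_coe]
  refine card_le_of_chain
    (τ := fun A : innerSeparated (m + 1) d => -dividedDifference g ((A : Finset ℕ) ∪
      (A : Finset ℕ).image (· - 1))) (fun A A' h => ?_)
    (finite_not_isGeneric_pencilHeights m (2 * d) g)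
    (fun t => if ht : IsGeneric m (2 * d) (pencilHeights (2 * d) g t) then
      ι (regularTriangulation hm ht) else ∅) fun s hs t ht => ?_
  · exact Subtype.ext (injOn_union_pred (m + 1) d A.2 A'.2
      (hginj _ (hZ A A.2).1 (hZ A A.2).2 _ (hZ A' A'.2).1 (hZ A' A'.2).2 (neg_injective h)))
  · have hs' := not_not.1 hs
    have ht' := not_not.1 ht
    simp only [hs', ht', dif_pos]
    change ι (regularTriangulation hm hs') ≤ ι (regularTriangulation hm ht') ↔ _
    rw [ι.le_iff_le, le_iff_submersionSet_subset hm]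
    constructor
    · intro h A hA
      exact (hmem t ht' A A.2).1 (h ((hmem s hs' A A.2).2 hA))
    · intro h A hA
      have hAI : A ∈ innerSeparated (m + 1) d := by
        rw [← internalNonLowerSimplices_eq_innerSeparated hm]
        exact (mem_inter.1 hA).2
      exact (hmem t ht' A hAI).2 (h ⟨A, hAI⟩ ((hmem s hs' A hAI).1 hA))

/-! ### Assembly of the theorem -/

theorem exists_orderEmbedding_finset {P α : Type*} [Preorder P] (I : Finset α) (s : P → Finset α)
    (hs : ∀ T, s T ⊆ I) (hle : ∀ T T', T ≤ T' ↔ s T ⊆ s T')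
    (hanti : ∀ T T' : P, T ≤ T' → T' ≤ T → T = T') :
    ∃ ι : P ↪o Finset I, ∀ T, (ι T).map (Function.Embedding.subtype _) = s T := by
  classical
  have hmap : ∀ T, ((s T).subtype (· ∈ I)).map (Function.Embedding.subtype _) = s T := fun T => by
    rw [subtype_map, filter_true_of_mem fun a ha => hs T ha]
  have hiff : ∀ T T', (s T).subtype (· ∈ I) ⊆ (s T').subtype (· ∈ I) ↔ T ≤ T' := fun T T' => by
    rw [hle, ← map_subset_map (f := Function.Embedding.subtype (· ∈ I)), hmap, hmap]
  exact ⟨⟨⟨fun T => (s T).subtype (· ∈ I), fun T T' h => hanti T T'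
    ((hiff T T').1 (subset_of_eq h)) ((hiff T' T).1 (subset_of_eq h.symm))⟩, hiff _ _⟩, hmap⟩

theorem mainTheorem11 (m d : ℕ) :
    (2 * d + 2 ≤ m →
      internalSimplices m (2 * d + 1) d = innerSeparated m d ∧
      (internalSimplices m (2 * d + 1) d).card = (m - d - 2).choose (d + 1) ∧
      (∃ ι : Triangulation m (2 * d + 1) ↪o (Finset ↥(internalSimplices m (2 * d + 1) d))ᵒᵈ,
        ∀ T, (OrderDual.ofDual (ι T)).map (Function.Embedding.subtype _) = T.internalFaces d) ∧
      (∀ N : ℕ, Nonempty (Triangulation m (2 * d + 1) ↪o (Finset (Fin N))ᵒᵈ) →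
        (m - d - 2).choose (d + 1) ≤ N)) ∧
    (1 ≤ d → 2 * d + 1 ≤ m →
      internalNonLowerSimplices m (2 * d) d = innerSeparated (m + 1) d ∧
      (internalNonLowerSimplices m (2 * d) d).card = (m - d - 1).choose (d + 1) ∧
      (∃ ι : Triangulation m (2 * d) ↪o Finset ↥(internalNonLowerSimplices m (2 * d) d),
        ∀ T, (ι T).map (Function.Embedding.subtype _) =
          T.submersionSet d ∩ internalNonLowerSimplices m (2 * d) d) ∧
      (∀ N : ℕ, Nonempty (Triangulation m (2 * d) ↪o Finset (Fin N)) →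
        (m - d - 1).choose (d + 1) ≤ N)) := by
  refine ⟨fun hm => ?_, fun hd hm => ?_⟩
  · have heq := internalSimplices_eq_innerSeparated hm
    have hcard : #(innerSeparated m d) = (m - d - 2).choose (d + 1) :=
      card_innerSeparated (by omega)
    refine ⟨heq, by rw [heq, hcard], ?_, ?_⟩
    · obtain ⟨ι, hι⟩ := exists_orderEmbedding_finset (P := (Triangulation m (2 * d + 1))ᵒᵈ)
        (internalSimplices m (2 * d + 1) d) (fun T => (OrderDual.ofDual T).internalFaces d)
        (fun T A hA => (Triangulation.mem_internalFaces.1 hA).1)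
        (fun T T' => le_iff_internalFaces_subset hm (OrderDual.ofDual T') (OrderDual.ofDual T))
        (fun T T' h h' => Triangulation.eq_of_le_of_le _ _ h' h)
      exact ⟨ι.dual, hι⟩
    · rintro N ⟨ι⟩
      exact hcard ▸ card_le_of_orderEmbedding_odd hm ι
  · have heq := internalNonLowerSimplices_eq_innerSeparated hm
    have hcard : #(innerSeparated (m + 1) d) = (m - d - 1).choose (d + 1) := by
      rw [card_innerSeparated (by omega)]
      congr 1
      omega
    refine ⟨heq, by rw [heq, hcard], ?_, ?_⟩
    · exact exists_orderEmbedding_finset _ _ (fun T => inter_subset_right)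
        (le_iff_submersionSet_subset hm) fun T T' => T.eq_of_le_of_le T'
    · rintro N ⟨ι⟩
      exact hcard ▸ card_le_of_orderEmbedding_even hm ι
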